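/- **Conventions.** Let $(X,d)$ be a metric space, and let $\langle x|y\rangle_z=\tfrac12\big(d(x,z)+d(y,z)-d(x,y)\big)$ be the Gromov product. Assume that $X$ is Gromov hyperbolic (not necessarily proper or geodesic): there is a constant $C$ with $\langle x|z\rangle_w\ge\min(\langle x|y\rangle_w,\langle y|z\rangle_w)-C$ for all $x,y,z,w\in X$. Fix $o\in X$. A Gromov sequence is a sequence $(x_n)$ in $X$ with $\langle x_n|x_m\rangle_o\to\infty$ as $n,m\to\infty$; two such sequences $(x_n),(y_n)$ are equivalent if $\langle x_n|y_n\rangle_o\to\infty$, and $\partial X$ is the set of equivalence classes. For $\xi,\eta\in\partial X$ and $y,z\in X$ put $\langle\xi|\eta\rangle_z=\inf\liminf_{n,m}\langle x_n|y_m\rangle_z$ and $\langle y|\xi\rangle_z=\inf\liminf_n\langle x_n|y\rangle_z$, the infima being over $(x_n)\in\xi$, $(y_m)\in\eta$. Let $b>1$ and let $D$ be a visual metric on $\partial X$, i.e. a metric for which there is $C>0$ with $C^{-1}b^{-\langle\xi|\eta\rangle_o}\le D(\xi,\eta)\le C\,b^{-\langle\xi|\eta\rangle_o}$ for all $\xi,\eta\in\partial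 X$. All metric notions on $\partial X$, in particular the Hausdorff dimension $\mathrm{HD}$, refer to $D$, and $B(z,r)$ is a closed ball. Isometries of $X$ are bijective and act on $\partial X$. An isometry $g$ is loxodromic if it has two distinct fixed points $g_+,g_-\in\partial X$ such that for every neighborhood $U$ of $g_-$ the iterates $g^n$ converge to $g_+$ uniformly on $\partial X\setminus U$, and the same holds for $g^{-1}$ with $g_+,g_-$ exchanged. Let $G$ be a group of isometries of $X$ that is strongly discrete ($\{g\in G: d(o,g(o))\le r\}$ is finite for every $r>0$) and of general type (it contains two loxodromic isometries $g_1,g_2$ with $\{g_{1,+},g_{1,-}\}\cap\{g_{2,+},g_{2,-}\}=\emptyset$). Its Poincaré exponent is $\delta=\inf\{s\ge0:\sum_{g\in G}b^{-s\,d(o,g(o))}<\infty\}\in[0,\infty]$. For $x\in X$ and $\sigma\in\mathbb R$ let $\mathrm{Shad}(x,\sigma)=\{\eta\in\partial X:\langle o|\eta\rangle_x\le\sigma\}$. The radial limit set $\Lambda_r$ is the set of $\eta\in\partial X$ for which there are $\sigma>0$ and a sequence $(g_n)_{n\ge1}$ in $G$ with $\langle g_n(o)|\eta\rangle_o\to\infty$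 and $\eta\in\mathrm{Shad}(g_n(o),\sigma)$ for all $n$; the uniformly radial limit set $\Lambda_{ur}$ is the set of those $\eta$ for which $\sigma$ and $(g_n)$ can be chosen so that moreover $g_1(o)=o$ and $d(g_n(o),g_{n+1}(o))\le\sigma$ for all $n$. A partition structure on a metric space $(Z,D)$ consists of a nonempty tree $T$ (a set of finite words over $\mathbb N$, closed under initial segments) and closed bounded sets $(P_\omega)_{\omega\in T}$ of positive diameter $D_\omega$ such that: $P_\tau\subset P_\omega$ if $\omega$ is an initial segment of $\tau$; $P_\omega\cap P_\tau=\emptyset$ if neither of $\omega,\tau$ is an initial segment of the other; and there are $\kappa>0$ and $0<\lambda<1$ with $D(P_{\omega a},Z\setminus P_\omega)\ge\kappa D_\omega$ and $\kappa D_\omega\le D_{\omega a}\le\lambda D_\omega$ whenever $\omega,\omega a\in T$, where $a\in\mathbb N$ (the distance to the empty set being $+\infty$). Its limit set is the union of the sets $\bigcap_n P_{\omega_1\cdots\omega_n}$ over all infinite words $\omega$ all of whose finite initial segments belong to $T$. A nonempty set $J\subset Z$ is Ahlfors $s$-regular if it is the topological support of a finite Borel measure $\mu$ on $Z$ with $\mu(Z\setminus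 J)=0$ for which there is $C>0$ with $C^{-1}r^s\le\mu(B(z,r))\le C\,r^s$ for all $z\in J$ and $0<r<1$. **Theorem (generalized Bishop–Jones theorem).** Under these assumptions $$\mathrm{HD}(\Lambda_r)=\mathrm{HD}(\Lambda_{ur})=\delta .$$ Moreover, for every real $s$ with $0<s<\delta$ there is an Ahlfors $s$-regular set $\mathcal J_s\subset\Lambda_{ur}$. More precisely, for every such $s$ there is $\sigma_0$ such that for every $\sigma\ge\sigma_0$ there are a tree $T$ and an injective map $T\ni\omega\mapsto x_\omega\in G(o)$ for which the shadows $(\mathrm{Shad}(x_\omega,\sigma))_{\omega\in T}$ form a partition structure on $(\partial X,D)$ whose limit set $\mathcal J_s$ is contained in $\Lambda_{ur}$ and Ahlfors $s$-regular. -/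

import Mathlib

open Filter Topology Set MeasureTheory
open scoped ENNReal NNReal

namespace GromovHyp

noncomputable section

/-! ### Gromov products and hyperbolic metric spaces -/

/-- The Gromov product `⟨x|y⟩_z = (d(x,z) + d(y,z) - d(x,y)) / 2`. -/
def gromovProduct {X : Type*} [MetricSpace X] (x y z : X) : ℝ :=
  (dist x z + dist y z - dist x y) / 2

/-- A metric space (not necessarily geodesic or proper) is hyperbolic if Gromov's inequality
holds for all quadruples of points, up to a uniform additive constant. -/
class HyperbolicSpace (X : Type*) [MetricSpace X] : Prop where
  gromov_inequality : ∃ C : ℝ, ∀ x y z w : X,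
    min (gromovProduct x y w) (gromovProduct y z w) - C ≤ gromovProduct x z w

/-! ### The Gromov boundary -/

/-- A Gromov sequence: `⟨x_n|x_m⟩_z → ∞` as `n, m → ∞`. The condition for one basepoint `z` is
equivalent to the condition for every basepoint; all basepoints are asked for here so that
the definition does not depend on a choice. -/
def IsGromovSeq {X : Type*} [MetricSpace X] (x : ℕ → X) : Prop :=
  ∀ z : X, Tendsto (fun p : ℕ × ℕ => gromovProduct (x p.1) (x p.2) z) atTop atTop

/-- The type of Gromov sequences in `X`. -/
def GromovSeq (X : Type*) [MetricSpace X] : Type _ := {x : ℕ → X // IsGromovSeq x}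

/-- Equivalence of Gromov sequences: `⟨x_n|y_n⟩_z → ∞`. -/
def GromovEquiv {X : Type*} [MetricSpace X] (x y : GromovSeq X) : Prop :=
  ∀ z : X, Tendsto (fun n : ℕ => gromovProduct (x.1 n) (y.1 n) z) atTop atTop

theorem gromovProduct_comm {X : Type*} [MetricSpace X] (x y z : X) :
    gromovProduct x y z = gromovProduct y x z := by
  unfold gromovProduct
  rw [dist_comm x y]
  ring

theorem gromovEquiv_equivalence (X : Type*) [MetricSpace X] [HyperbolicSpace X] :
    Equivalence (GromovEquiv (X := X)) where
  refl := by
    intro x z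
    have h : Tendsto (fun n : ℕ => (n, n)) atTop (atTop : Filter (ℕ × ℕ)) := by
      rw [← prod_atTop_atTop_eq]
      exact tendsto_id.prodMk tendsto_id
    exact (x.2 z).comp h
  symm := by
    intro x y h z
    simpa only [gromovProduct_comm] using h z
  trans := by
    intro x y w hxy hyw z
    obtain ⟨C, hC⟩ := HyperbolicSpace.gromov_inequality (X := X)
    rw [tendsto_atTop]
    intro r
    filter_upwards [(tendsto_atTop.1 (hxy z)) (r + C), (tendsto_atTop.1 (hyw z)) (r + C)]
      with n h1 h2
    have h3 := hC (x.1 n) (y.1 n) (w.1 n) z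
    have h4 := le_min h1 h2
    linarith

/-- Equivalence of Gromov sequences, as a setoid. -/
def gromovSetoid (X : Type*) [MetricSpace X] [HyperbolicSpace X] : Setoid (GromovSeq X) where
  r := GromovEquiv
  iseqv := gromovEquiv_equivalence X

/-- The Gromov boundary `∂X`: Gromov sequences modulo equivalence. -/
def GromovBoundary (X : Type*) [MetricSpace X] [HyperbolicSpace X] : Type _ :=
  Quotient (gromovSetoid X)

/-- `x ∈ ξ`, for a Gromov sequence `x` and a boundary point `ξ`. -/
def Represents {X : Type*} [MetricSpace X] [HyperbolicSpace X]
    (x : GromovSeq X) (ξ : GromovBoundary X) : Prop :=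
  Quotient.mk (gromovSetoid X) x = ξ

/-- The Gromov product of two boundary points:
`⟨ξ|η⟩_z = inf {liminf_{n,m → ∞} ⟨x_n|y_m⟩_z : (x_n) ∈ ξ, (y_m) ∈ η}`, with value in `[0, ∞]`. -/
def boundaryProduct {X : Type*} [MetricSpace X] [HyperbolicSpace X]
    (ξ η : GromovBoundary X) (z : X) : EReal :=
  ⨅ (x : GromovSeq X) (y : GromovSeq X) (_ : Represents x ξ) (_ : Represents y η),
    liminf (fun p : ℕ × ℕ => ((gromovProduct (x.1 p.1) (y.1 p.2) z : ℝ) : EReal)) atTop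

/-- The Gromov product of a point `y` of `X` and a boundary point `ξ`:
`⟨y|ξ⟩_z = inf {liminf_n ⟨x_n|y⟩_z : (x_n) ∈ ξ}`. -/
def pointBoundaryProduct {X : Type*} [MetricSpace X] [HyperbolicSpace X]
    (y : X) (ξ : GromovBoundary X) (z : X) : EReal :=
  ⨅ (x : GromovSeq X) (_ : Represents x ξ),
    liminf (fun n : ℕ => ((gromovProduct (x.1 n) y z : ℝ) : EReal)) atTop

/-! ### Visual metrics -/

/-- `b ^ (-t)` for an extended real `t`, with `b ^ (-∞) = 0`. -/
def expNeg (b : ℝ) (t : EReal) : ℝ := if t = ⊤ then 0 else b ^ (-t.toReal)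

/-- The given metric on `∂X` is a visual metric with parameter `b`, based at `o`:
it is comparable to `b ^ (-⟨ξ|η⟩_o)` up to a multiplicative constant. -/
def IsVisualMetric (X : Type*) [MetricSpace X] [HyperbolicSpace X]
    [MetricSpace (GromovBoundary X)] (b : ℝ) (o : X) : Prop :=
  ∃ C : ℝ, 0 < C ∧ ∀ ξ η : GromovBoundary X,
    C⁻¹ * expNeg b (boundaryProduct ξ η o) ≤ dist ξ η ∧
      dist ξ η ≤ C * expNeg b (boundaryProduct ξ η o)

/-! ### Isometries and their extension to the boundary -/

theorem gromovProduct_isometryEquiv {X : Type*} [MetricSpace X] (g : X ≃ᵢ X) (x y z : X) :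
    gromovProduct (g x) (g y) z = gromovProduct x y (g.symm z) := by
  have h : ∀ w : X, dist (g w) z = dist w (g.symm z) := by
    intro w
    conv_lhs => rw [← g.apply_symm_apply z]
    exact g.isometry.dist_eq _ _
  unfold gromovProduct
  rw [h, h, g.isometry.dist_eq]

/-- The image of a Gromov sequence under an isometry. -/
def GromovSeq.map {X : Type*} [MetricSpace X] (g : X ≃ᵢ X) (x : GromovSeq X) : GromovSeq X :=
  ⟨fun n => g (x.1 n), fun z => by
    simpa only [gromovProduct_isometryEquiv] using x.2 (g.symm z)⟩

/-- The extension of an isometry of `X` to `∂X`. -/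
def boundaryMap {X : Type*} [MetricSpace X] [HyperbolicSpace X] (g : X ≃ᵢ X) :
    GromovBoundary X → GromovBoundary X :=
  Quotient.map' (s₁ := gromovSetoid X) (s₂ := gromovSetoid X) (GromovSeq.map g)
    (fun x y h z => by
      have h' : GromovEquiv x y := h
      simpa only [GromovSeq.map, gromovProduct_isometryEquiv] using h' (g.symm z))

/-- For every neighborhood `U` of `m`, the iterates `g ^ n` converge to `p` uniformly
on `∂X \ U`. -/
def Attracts {X : Type*} [MetricSpace X] [HyperbolicSpace X] [MetricSpace (GromovBoundary X)]
    (g : X ≃ᵢ X) (p m : GromovBoundary X) : Prop :=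
  ∀ U ∈ 𝓝 m, TendstoUniformlyOn (fun (n : ℕ) (ξ : GromovBoundary X) => boundaryMap (g ^ n) ξ)
    (fun _ => p) atTop Uᶜ

/-- `g` is loxodromic with attracting fixed point `p` and repelling fixed point `m`. -/
def IsLoxodromic {X : Type*} [MetricSpace X] [HyperbolicSpace X]
    [MetricSpace (GromovBoundary X)] (g : X ≃ᵢ X) (p m : GromovBoundary X) : Prop :=
  p ≠ m ∧ boundaryMap g p = p ∧ boundaryMap g m = m ∧ Attracts g p m ∧ Attracts g⁻¹ m p

/-- A group of isometries is of general type if it contains two loxodromic isometries without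
a common fixed point. -/
def IsGeneralType {X : Type*} [MetricSpace X] [HyperbolicSpace X]
    [MetricSpace (GromovBoundary X)] (G : Subgroup (X ≃ᵢ X)) : Prop :=
  ∃ g₁ ∈ G, ∃ g₂ ∈ G, ∃ p₁ m₁ p₂ m₂ : GromovBoundary X,
    IsLoxodromic g₁ p₁ m₁ ∧ IsLoxodromic g₂ p₂ m₂ ∧
      Disjoint ({p₁, m₁} : Set (GromovBoundary X)) {p₂, m₂}

/-- A group of isometries is strongly discrete (metrically proper) if, for each `r > 0`, only
finitely many of its elements move `o` by at most `r`. -/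
def IsStronglyDiscrete {X : Type*} [MetricSpace X] (G : Subgroup (X ≃ᵢ X)) (o : X) : Prop :=
  ∀ r : ℝ, 0 < r → {g : X ≃ᵢ X | g ∈ G ∧ dist o (g o) ≤ r}.Finite

/-! ### Poincaré exponent -/

/-- The Poincaré series `Σ_{g ∈ G} b ^ (-s d(o, g o))`, with value in `[0, ∞]`. -/
def poincareSeries {X : Type*} [MetricSpace X] (G : Subgroup (X ≃ᵢ X)) (b : ℝ) (o : X)
    (s : ℝ) : ℝ≥0∞ :=
  ∑' g : G, ENNReal.ofReal (b ^ (-(s * dist o ((g : X ≃ᵢ X) o))))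

/-- The Poincaré exponent relative to `b`: the infimum of all `s ≥ 0` with convergent Poincaré
series, `∞` if there are none. -/
def poincareExponent {X : Type*} [MetricSpace X] (G : Subgroup (X ≃ᵢ X)) (b : ℝ) (o : X) :
    ℝ≥0∞ :=
  ⨅ (s : ℝ≥0) (_ : poincareSeries G b o (s : ℝ) < ∞), (s : ℝ≥0∞)

/-! ### Shadows and limit sets -/

/-- The shadow cast by `x` from the light source `o`: all `η` in `∂X` with `⟨o|η⟩_x ≤ σ`. -/
def shadow {X : Type*} [MetricSpace X] [HyperbolicSpace X] (o x : X) (σ : ℝ) :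
    Set (GromovBoundary X) :=
  {η | pointBoundaryProduct o η x ≤ (σ : EReal)}

/-- A sequence in `X` converges to a boundary point: `⟨x_n|η⟩_o → ∞`. -/
def ConvergesTo {X : Type*} [MetricSpace X] [HyperbolicSpace X] (o : X) (x : ℕ → X)
    (η : GromovBoundary X) : Prop :=
  Tendsto (fun n => pointBoundaryProduct (x n) η o) atTop (𝓝 ⊤)

/-- `σ`-radial convergence. -/
def ConvergesRadially {X : Type*} [MetricSpace X] [HyperbolicSpace X] (o : X) (σ : ℝ)
    (x : ℕ → X) (η : GromovBoundary X) : Prop :=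
  ConvergesTo o x η ∧ ∀ n, η ∈ shadow o (x n) σ

/-- `σ`-uniformly radial convergence. -/
def ConvergesUniformlyRadially {X : Type*} [MetricSpace X] [HyperbolicSpace X] (o : X) (σ : ℝ)
    (x : ℕ → X) (η : GromovBoundary X) : Prop :=
  ConvergesRadially o σ x η ∧ (∀ n, dist (x n) (x (n + 1)) ≤ σ) ∧ x 0 = o

/-- The radial limit set of `G`. -/
def radialLimitSet {X : Type*} [MetricSpace X] [HyperbolicSpace X] (G : Subgroup (X ≃ᵢ X))
    (o : X) : Set (GromovBoundary X) :=
  {η | ∃ g : ℕ → X ≃ᵢ X, (∀ n, g n ∈ G) ∧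
    ∃ σ : ℝ, 0 < σ ∧ ConvergesRadially o σ (fun n => g n o) η}

/-- The uniformly radial limit set of `G`. -/
def uniformlyRadialLimitSet {X : Type*} [MetricSpace X] [HyperbolicSpace X]
    (G : Subgroup (X ≃ᵢ X)) (o : X) : Set (GromovBoundary X) :=
  {η | ∃ g : ℕ → X ≃ᵢ X, (∀ n, g n ∈ G) ∧
    ∃ σ : ℝ, 0 < σ ∧ ConvergesUniformlyRadially o σ (fun n => g n o) η}

/-! ### Partition structures -/

/-- A (nonempty) tree on `ℕ`: a set of finite words which is closed under initial segments. -/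
def IsTree (T : Set (List ℕ)) : Prop :=
  T.Nonempty ∧ ∀ ω τ : List ℕ, ω <+: τ → τ ∈ T → ω ∈ T

/-- A partition structure on `Z`: a tree `T` and closed sets `P ω`, for `ω ∈ T` (the values of
`P` off `T` are irrelevant), of positive and finite diameter. -/
structure IsPartitionStructure {Z : Type*} [MetricSpace Z] (T : Set (List ℕ))
    (P : List ℕ → Set Z) : Prop where
  isTree : IsTree T
  isClosed : ∀ ω ∈ T, IsClosed (P ω)
  isBounded : ∀ ω ∈ T, Bornology.IsBounded (P ω)
  diam_pos : ∀ ω ∈ T, 0 < Metric.diam (P ω)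
  nested : ∀ ω ∈ T, ∀ τ ∈ T, ω <+: τ → P τ ⊆ P ω
  disjoint : ∀ ω ∈ T, ∀ τ ∈ T, ¬ ω <+: τ → ¬ τ <+: ω → Disjoint (P ω) (P τ)
  geometry : ∃ κ lam : ℝ, 0 < κ ∧ 0 < lam ∧ lam < 1 ∧
    ∀ (ω : List ℕ) (a : ℕ), ω ∈ T → ω ++ [a] ∈ T →
      (∀ y ∈ P (ω ++ [a]), ∀ z ∉ P ω, κ * Metric.diam (P ω) ≤ dist y z) ∧
      κ * Metric.diam (P ω) ≤ Metric.diam (P (ω ++ [a])) ∧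
      Metric.diam (P (ω ++ [a])) ≤ lam * Metric.diam (P ω)

/-- The initial segment of length `n` of an infinite word. -/
def initialSegment (ω : ℕ → ℕ) (n : ℕ) : List ℕ := (List.range n).map ω

/-- The limit set of a partition structure: the union, over all infinite branches `ω` of the
tree, of the sets `⋂ n, P (ω_1 ... ω_n)` (each of which has at most one point). -/
def partitionLimitSet {Z : Type*} (T : Set (List ℕ)) (P : List ℕ → Set Z) : Set Z :=
  {z | ∃ ω : ℕ → ℕ, ∀ n, initialSegment ω n ∈ T ∧ z ∈ P (initialSegment ω n)}

/-! ### Ahlfors regularity -/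

/-- A measure is Ahlfors `s`-regular if `μ (B(z,r)) ≍ r ^ s` for all `z` in the topological
support of `μ` and all `0 < r < 1`, where `B(z,r)` is the closed ball. -/
def IsAhlforsRegularMeasure {Z : Type*} [MetricSpace Z] [MeasurableSpace Z] (s : ℝ)
    (μ : Measure Z) : Prop :=
  ∃ C : ℝ, 0 < C ∧ ∀ z ∈ μ.support, ∀ r : ℝ, 0 < r → r < 1 →
    ENNReal.ofReal (C⁻¹ * r ^ s) ≤ μ (Metric.closedBall z r) ∧
      μ (Metric.closedBall z r) ≤ ENNReal.ofReal (C * r ^ s)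

/-- A nonempty subset `J` of `Z` is Ahlfors `s`-regular if it is the topological support of an
Ahlfors `s`-regular finite measure living on `J`. -/
def IsAhlforsRegularSet {Z : Type*} [MetricSpace Z] [MeasurableSpace Z] (s : ℝ)
    (J : Set Z) : Prop :=
  J.Nonempty ∧ ∃ μ : Measure Z, IsFiniteMeasure μ ∧ μ.support = J ∧ μ Jᶜ = 0 ∧
    IsAhlforsRegularMeasure s μ

end

end GromovHyp

namespace GromovHyp

/-! ### Elementary properties of the Gromov product -/

section Elementary

variable {X : Type*} [MetricSpace X]

/-! The shadow of an orbit point `g o` has diameter comparable to `b ^ (-d(o, g o))`. For the upper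
bound (`dimH_radialLimitSet_le`), fix a natural number `σ`: the points lying in `σ`-shadows of
arbitrarily distant orbit points are covered, for each `n`, by the shadows of the `g o` with `d(o, g
o) > n`. The sum of the `s`-th powers of their diameters is at most a constant times the Poincaré
series, so a convergent series bounds the Hausdorff dimension.

For the lower bound let `s < s' < δ`. Divergence of the series at `s'` forces some annuli `n ≤ d(o,
g o) < n + 1`, with `n` arbitrarily large, to contain any prescribed multiple of `b ^ (s * n)` orbit
elements (`exists_large_annulus`), and a fixed proportion of them can be made far apart
(`exists_separated_subset`). General type supplies `f`, `g` such that `f o`, `f⁻¹ o`, `g o`, `g⁻¹ o`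
point in four different directions. Multiplying by one of `f`, `g`, or by one of their inverses,
turns half of the family into a known direction, and from any orbit point at least one of these two
copies leads away from `o` (`exists_children`). Thus every orbit point has many children at almost
constant distance.

Each vertex keeps just as many of these children as are needed for an equal division of its mass to
give mass comparable to `b ^ (-s * d(o, x))`, with constants that do not deteriorate along the tree
(`exists_weightedTree`). Hyperbolicity makes the shadows of the tree a partition structure
(`isPartitionStructure_shadow`). Each branch is itself a Gromov sequence, so its limit point exists
without properness of `X`. Coding an interval by branches and pushing Lebesgue measure forward gives
a measure with the prescribed masses, and the gaps between successive generations make it Ahlfors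
`s`-regular. A mass distribution argument (`IsAhlforsRegularSet.le_dimH`) then bounds the dimension
from below; bounded steps along the branches put the limit set inside the uniformly radial one. -/

theorem gromovProduct_nonneg (x y z : X) : 0 ≤ gromovProduct x y z := by
  have := dist_triangle_right x y z
  unfold gromovProduct
  linarith

theorem gromovProduct_le_dist_left (x y z : X) : gromovProduct x y z ≤ dist x z := by
  have := dist_triangle y x z
  rw [dist_comm y x] at this
  unfold gromovProduct
  linarith

theorem gromovProduct_le_dist_right (x y z : X) : gromovProduct x y z ≤ dist y z := by
  rw [gromovProduct_comm]
  exact gromovProduct_le_dist_left y x z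

/-- An identity that needs no hyperbolicity: a small product seen from one endpoint is an almost
maximal product seen from the other. This is how shadow conditions at an orbit point become
closeness estimates at `o`. -/
theorem gromovProduct_add_swap (x y z : X) :
    gromovProduct x y z + gromovProduct z y x = dist x z := by
  unfold gromovProduct
  rw [dist_comm z x, dist_comm y z, dist_comm y x]
  ring

theorem gromovProduct_le_add_dist (x y z w : X) :
    gromovProduct x y z ≤ gromovProduct x y w + dist z w := by
  have h₁ := dist_triangle_right x z w
  have h₂ := dist_triangle_right y z w
  unfold gromovProduct
  linarith

theorem gromovProduct_map_map (g : X ≃ᵢ X) (x y z : X) :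
    gromovProduct (g x) (g y) (g z) = gromovProduct x y z := by
  simp only [gromovProduct, g.isometry.dist_eq]

theorem gromovProduct_self_left (x y : X) : gromovProduct x y x = 0 := by
  simp [gromovProduct, dist_comm]

/-- `C` is a constant for which Gromov's inequality holds. -/
def IsHypConst (X : Type*) [MetricSpace X] (C : ℝ) : Prop :=
  0 ≤ C ∧ ∀ x y z w : X, min (gromovProduct x y w) (gromovProduct y z w) - C ≤ gromovProduct x z w

theorem exists_isHypConst (X : Type*) [MetricSpace X] [HyperbolicSpace X] :
    ∃ C, IsHypConst X C := by
  obtain ⟨C, hC⟩ := HyperbolicSpace.gromov_inequality (X := X)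
  exact ⟨max C 0, le_max_right _ _, fun x y z w => by
    linarith [hC x y z w, le_max_left C 0]⟩

theorem IsHypConst.lt {C : ℝ} (hC : IsHypConst X C) {x y z w : X} {t : ℝ}
    (h₁ : t + C < gromovProduct x y w) (h₂ : t + C < gromovProduct y z w) :
    t < gromovProduct x z w := by
  have := hC.2 x y z w
  have := lt_min h₁ h₂
  linarith

theorem IsHypConst.le {C : ℝ} (hC : IsHypConst X C) {x y z w : X} {t : ℝ}
    (h₁ : t + C ≤ gromovProduct x y w) (h₂ : t + C ≤ gromovProduct y z w) :
    t ≤ gromovProduct x z w := by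
  have := hC.2 x y z w
  have := le_min h₁ h₂
  linarith

/-- If `⟨x|z⟩ ≤ t` and `⟨y|z⟩` is large, then `⟨x|y⟩ ≤ t + C`. -/
theorem IsHypConst.le_left {C : ℝ} (hC : IsHypConst X C) {x y z w : X} {t : ℝ}
    (h : gromovProduct x z w ≤ t) (h₁ : t + C < gromovProduct y z w) :
    gromovProduct x y w ≤ t + C := by
  by_contra! h₂
  exact (hC.lt h₂ h₁).not_ge h

end Elementary

/-! ### Gromov sequences and boundary points -/

section Boundary

variable {X : Type*} [MetricSpace X] [HyperbolicSpace X] {C b : ℝ} {o : X}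

theorem exists_represents (ξ : GromovBoundary X) : ∃ x : GromovSeq X, Represents x ξ :=
  Quotient.exists_rep ξ

theorem Represents.equiv {x y : GromovSeq X} {ξ : GromovBoundary X} (hx : Represents x ξ)
    (hy : Represents y ξ) : GromovEquiv x y :=
  Quotient.exact (s := gromovSetoid X) (hx.trans hy.symm)

theorem Represents.map {x : GromovSeq X} {ξ : GromovBoundary X} (hx : Represents x ξ)
    (g : X ≃ᵢ X) : Represents (x.map g) (boundaryMap g ξ) := by
  subst hx
  rfl

theorem boundaryMap_one (ξ : GromovBoundary X) : boundaryMap (1 : X ≃ᵢ X) ξ = ξ := by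
  obtain ⟨x, rfl⟩ := exists_represents ξ
  rfl

/-- Two Gromov sequences in the same class are jointly close. -/
theorem Represents.eventually_lt {x y : GromovSeq X} {ξ : GromovBoundary X} (hx : Represents x ξ)
    (hy : Represents y ξ) (z : X) (t : ℝ) :
    ∃ N, ∀ n ≥ N, ∀ m ≥ N, t < gromovProduct (x.1 n) (y.1 m) z := by
  obtain ⟨C, hC⟩ := exists_isHypConst X
  have h₁ := (hx.equiv hy z).eventually_gt_atTop (t + C)
  have h₂ := (y.2 z).eventually_gt_atTop (t + C)
  rw [eventually_atTop] at h₁ h₂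
  obtain ⟨N, hN⟩ := h₁
  obtain ⟨M, hM⟩ := h₂
  refine ⟨max N (max M.1 M.2), fun n hn m hm => ?_⟩
  simp only [ge_iff_le, max_le_iff] at hn hm
  exact hC.lt (hN n hn.1) (hM (n, m) ⟨hn.2.1, hm.2.2⟩)

theorem boundaryProduct_le {x y : GromovSeq X} {ξ η : GromovBoundary X} (hx : Represents x ξ)
    (hy : Represents y η) {z : X} {t : ℝ}
    (h : ∃ᶠ p : ℕ × ℕ in atTop, gromovProduct (x.1 p.1) (y.1 p.2) z ≤ t) :
    boundaryProduct ξ η z ≤ t :=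
  (iInf₂_le_of_le x y (iInf₂_le_of_le hx hy le_rfl)).trans
    (liminf_le_of_frequently_le' (h.mono fun _ hp => EReal.coe_le_coe_iff.2 hp))

theorem boundaryProduct_nonneg (ξ η : GromovBoundary X) (z : X) : 0 ≤ boundaryProduct ξ η z :=
  le_iInf₂ fun _ _ => le_iInf₂ fun _ _ => le_liminf_of_le
    (by isBoundedDefault) (Eventually.of_forall fun _ =>
      EReal.coe_nonneg.2 (gromovProduct_nonneg _ _ _))

/-- Two applications of the hyperbolic inequality replace a nearly minimizing pair of
representatives by the given pair. Up to `2 * C`, the infimum over representatives is therefore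
harmless. -/
theorem eventually_of_boundaryProduct_lt (hC : IsHypConst X C) {x y : GromovSeq X}
    {ξ η : GromovBoundary X} (hx : Represents x ξ) (hy : Represents y η) {z : X} {t : ℝ}
    (h : boundaryProduct ξ η z < t) :
    ∀ᶠ p : ℕ × ℕ in atTop, gromovProduct (x.1 p.1) (y.1 p.2) z < t + 2 * C := by
  simp only [boundaryProduct, iInf_lt_iff] at h
  obtain ⟨x', y', hx', hy', h⟩ := h
  have h := frequently_lt_of_liminf_lt (by isBoundedDefault) h
  obtain ⟨N, hN⟩ := hx'.eventually_lt hx z (t + 2 * C)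
  obtain ⟨M, hM⟩ := hy.eventually_lt hy' z (t + 2 * C)
  obtain ⟨p, hp, hpN⟩ := (h.and_eventually (eventually_ge_atTop (N, M))).exists
  filter_upwards [eventually_ge_atTop (N, M)] with q hq
  by_contra! hlt
  have h₁ := hN p.1 hpN.1 q.1 hq.1
  have h₂ := hM q.2 hq.2 p.2 hpN.2
  have h₃ : t + C ≤ gromovProduct (x'.1 p.1) (y.1 q.2) z :=
    hC.le (by linarith) (by linarith)
  have h₄ : t ≤ gromovProduct (x'.1 p.1) (y'.1 p.2) z := hC.le h₃ (by linarith [hC.1])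
  exact (EReal.coe_lt_coe_iff.1 hp).not_ge h₄

theorem pointBoundaryProduct_le {x : GromovSeq X} {ξ : GromovBoundary X} (hx : Represents x ξ)
    {y z : X} {t : ℝ} (h : ∃ᶠ n in atTop, gromovProduct (x.1 n) y z ≤ t) :
    pointBoundaryProduct y ξ z ≤ t :=
  (iInf₂_le_of_le x hx le_rfl).trans
    (liminf_le_of_frequently_le' (h.mono fun _ hp => EReal.coe_le_coe_iff.2 hp))

theorem exists_frequently_of_pointBoundaryProduct_lt {ξ : GromovBoundary X} {y z : X} {t : ℝ}
    (h : pointBoundaryProduct y ξ z < t) : ∃ x : GromovSeq X, Represents x ξ ∧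
      ∃ᶠ n in atTop, gromovProduct (x.1 n) y z < t := by
  simp only [pointBoundaryProduct, iInf_lt_iff] at h
  obtain ⟨x', hx', h⟩ := h
  exact ⟨x', hx', (frequently_lt_of_liminf_lt (by isBoundedDefault) h).mono fun n hn =>
    EReal.coe_lt_coe_iff.1 hn⟩

theorem eventually_of_pointBoundaryProduct_lt (hC : IsHypConst X C) {x : GromovSeq X}
    {ξ : GromovBoundary X} (hx : Represents x ξ) {y z : X} {t : ℝ}
    (h : pointBoundaryProduct y ξ z < t) :
    ∀ᶠ n in atTop, gromovProduct (x.1 n) y z < t + C := by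
  obtain ⟨x', hx', h⟩ := exists_frequently_of_pointBoundaryProduct_lt h
  obtain ⟨N, hN⟩ := hx'.eventually_lt hx z (t + C)
  obtain ⟨p, hp, hpN⟩ := (h.and_eventually (eventually_ge_atTop N)).exists
  filter_upwards [eventually_ge_atTop N] with q hq
  by_contra! hlt
  exact (hC.le (hN p hpN q hq).le hlt).not_gt hp

theorem eventually_of_lt_pointBoundaryProduct {x : GromovSeq X}
    {ξ : GromovBoundary X} (hx : Represents x ξ) {y z : X} {t : ℝ}
    (h : (t : EReal) < pointBoundaryProduct y ξ z) :
    ∀ᶠ n in atTop, t < gromovProduct (x.1 n) y z := by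
  by_contra hn
  simp only [not_eventually, not_lt] at hn
  exact (pointBoundaryProduct_le hx hn).not_gt h

theorem le_pointBoundaryProduct (hC : IsHypConst X C) {x : GromovSeq X}
    {ξ : GromovBoundary X} (hx : Represents x ξ) {y z : X} {t : ℝ}
    (h : ∃ᶠ n in atTop, t + C ≤ gromovProduct (x.1 n) y z) :
    (t : EReal) ≤ pointBoundaryProduct y ξ z := by
  by_contra! hlt
  obtain ⟨n, hn, hn'⟩ := (h.and_eventually (eventually_of_pointBoundaryProduct_lt hC hx hlt)).exists
  exact hn.not_gt hn'

theorem shadow_mono {x : X} {σ τ : ℝ} (h : σ ≤ τ) : shadow o x σ ⊆ shadow o x τ :=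
  fun _ hη => le_trans (show pointBoundaryProduct _ _ _ ≤ _ from hη) (EReal.coe_le_coe_iff.2 h)

theorem mem_shadow_of_frequently {x : GromovSeq X} {ξ : GromovBoundary X} (hx : Represents x ξ)
    {y : X} {σ : ℝ} (h : ∃ᶠ n in atTop, gromovProduct (x.1 n) o y ≤ σ) : ξ ∈ shadow o y σ :=
  pointBoundaryProduct_le hx h

/-- The term `1` makes the inequality strict and `C` pays for the change of representative. In the
other direction a bound along a subsequence of one representative suffices, with no loss. -/
theorem eventually_of_mem_shadow (hC : IsHypConst X C) {x : GromovSeq X}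
    {ξ : GromovBoundary X} (hx : Represents x ξ) {y : X} {σ : ℝ} (h : ξ ∈ shadow o y σ) :
    ∀ᶠ n in atTop, gromovProduct (x.1 n) o y < σ + 1 + C :=
  eventually_of_pointBoundaryProduct_lt hC hx
    (lt_of_le_of_lt h (EReal.coe_lt_coe_iff.2 (by linarith)))

theorem eventually_of_notMem_shadow {x : GromovSeq X}
    {ξ : GromovBoundary X} (hx : Represents x ξ) {y : X} {σ : ℝ} (h : ξ ∉ shadow o y σ) :
    ∀ᶠ n in atTop, σ < gromovProduct (x.1 n) o y :=
  eventually_of_lt_pointBoundaryProduct hx (not_le.1 h)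

/-- A sequence in `X` which approximates a boundary point along a Gromov sequence represents that
boundary point. -/
theorem exists_represents_of_forall_eventually {w : GromovSeq X} {η : GromovBoundary X}
    (hw : Represents w η) {v : ℕ → X}
    (hv : ∀ k : ℕ, ∀ᶠ m in atTop, (k : ℝ) < gromovProduct (v k) (w.1 m) o) :
    ∃ h : IsGromovSeq v, Represents ⟨v, h⟩ η := by
  obtain ⟨C, hC⟩ := exists_isHypConst X
  have key : ∀ (t : ℝ) (k : ℕ), t + C < k → ∀ᶠ m in atTop,
      t + C < gromovProduct (v k) (w.1 m) o := fun t k hk => (hv k).mono fun m hm => hk.trans hm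
  have h : IsGromovSeq v := by
    intro z
    refine tendsto_atTop.2 fun t => ?_
    obtain ⟨N, hN⟩ := exists_nat_gt (t + dist o z + C)
    filter_upwards [eventually_ge_atTop (N, N)] with p hp
    have hp1 : (N : ℝ) ≤ p.1 := by exact_mod_cast hp.1
    have hp2 : (N : ℝ) ≤ p.2 := by exact_mod_cast hp.2
    obtain ⟨m, hm, hm'⟩ := ((key (t + dist o z) p.1 (by linarith)).and
      (key (t + dist o z) p.2 (by linarith))).exists
    rw [gromovProduct_comm (v p.2)] at hm'
    have := hC.lt hm hm'
    have := gromovProduct_le_add_dist (v p.1) (v p.2) o z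
    linarith
  refine ⟨h, Eq.trans (Quotient.sound (s := gromovSetoid X) ?_) hw⟩
  intro z
  refine tendsto_atTop.2 fun t => ?_
  obtain ⟨N, hN⟩ := exists_nat_gt (t + dist o z + C)
  obtain ⟨M, hM⟩ := hw.eventually_lt hw o (t + dist o z + C)
  filter_upwards [eventually_ge_atTop N, eventually_ge_atTop M] with k hk hkM
  have hk' : (N : ℝ) ≤ k := by exact_mod_cast hk
  obtain ⟨m, hm, hm'⟩ := ((key (t + dist o z) k (by linarith)).and
    (eventually_ge_atTop M)).exists
  have h₁ := hM m hm' k hkM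
  have := hC.lt hm h₁
  have := gromovProduct_le_add_dist (v k) (w.1 k) o z
  show t ≤ gromovProduct (v k) (w.1 k) z
  linarith

/-! ### Visual metrics in terms of representatives -/

/-- The metric on the boundary is comparable, with constant `c`, to `b ^ (-⟨x_n|y_m⟩_o)` for
representatives `x`, `y` and large `n`, `m`. -/
def IsVisualConst (X : Type*) [MetricSpace X] [HyperbolicSpace X] [MetricSpace (GromovBoundary X)]
    (b : ℝ) (o : X) (c : ℝ) : Prop :=
  0 < c ∧ ∀ (ξ η : GromovBoundary X) (x y : GromovSeq X), Represents x ξ → Represents y η → ∀ t : ℝ,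
    ((∃ᶠ p : ℕ × ℕ in atTop, gromovProduct (x.1 p.1) (y.1 p.2) o ≤ t) →
      c⁻¹ * b ^ (-t) ≤ dist ξ η) ∧
    ((∃ᶠ p : ℕ × ℕ in atTop, t ≤ gromovProduct (x.1 p.1) (y.1 p.2) o) → dist ξ η ≤ c * b ^ (-t))

theorem IsVisualMetric.exists_isVisualConst [MetricSpace (GromovBoundary X)] (hb : 1 < b)
    (hD : IsVisualMetric X b o) : ∃ c, IsVisualConst X b o c := by
  obtain ⟨C, hC⟩ := exists_isHypConst X
  obtain ⟨K, hK, hD⟩ := hD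
  have hb0 : 0 < b := by linarith
  have h1 : 1 ≤ b ^ (2 * C) := Real.one_le_rpow hb.le (by linarith [hC.1])
  -- The factor `b ^ (2 * C)` absorbs the error `2 * C` made in passing to arbitrary
  -- representatives.
  refine ⟨K * b ^ (2 * C), by positivity, fun ξ η x y hx hy t => ⟨fun h => ?_, fun h => ?_⟩⟩
  · refine le_trans ?_ (hD ξ η).1
    have hle := boundaryProduct_le hx hy h
    have hne : boundaryProduct ξ η o ≠ ⊤ := ne_top_of_le_ne_top (EReal.coe_ne_top t) hle
    have hnb : boundaryProduct ξ η o ≠ ⊥ := fun hbot => by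
      have := boundaryProduct_nonneg ξ η o
      simp [hbot] at this
    have hexp : b ^ (-t) ≤ expNeg b (boundaryProduct ξ η o) := by
      rw [expNeg, if_neg hne]
      refine Real.rpow_le_rpow_of_exponent_le hb.le (neg_le_neg ?_)
      rwa [← EReal.coe_le_coe_iff, EReal.coe_toReal hne hnb]
    refine mul_le_mul ?_ hexp (by positivity) (by positivity)
    exact inv_anti₀ hK (le_mul_of_one_le_right hK.le h1)
  · refine (hD ξ η).2.trans ?_
    rw [mul_assoc, ← Real.rpow_add hb0]
    refine mul_le_mul_of_nonneg_left ?_ hK.le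
    unfold expNeg
    split_ifs with htop
    · positivity
    · refine Real.rpow_le_rpow_of_exponent_le hb.le ?_
      have : ((t - 2 * C : ℝ) : EReal) ≤ boundaryProduct ξ η o := by
        by_contra! hlt
        obtain ⟨p, hp, hp'⟩ :=
          (h.and_eventually (eventually_of_boundaryProduct_lt hC hx hy hlt)).exists
        linarith
      have hnb : boundaryProduct ξ η o ≠ ⊥ := fun hbot => by
        have := boundaryProduct_nonneg ξ η o
        simp [hbot] at this
      rw [← EReal.coe_toReal htop hnb, EReal.coe_le_coe_iff] at this
      linarith

variable [MetricSpace (GromovBoundary X)] {c : ℝ}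

/-- Distinct boundary points have bounded Gromov products. -/
theorem IsVisualConst.exists_bound (hb : 1 < b) (hc : IsVisualConst X b o c)
    {ξ η : GromovBoundary X} (hne : ξ ≠ η) {x y : GromovSeq X} (hx : Represents x ξ)
    (hy : Represents y η) :
    ∃ E, ∀ᶠ p : ℕ × ℕ in atTop, gromovProduct (x.1 p.1) (y.1 p.2) o ≤ E := by
  have hd : 0 < dist ξ η / c := div_pos (dist_pos.2 hne) hc.1
  -- For this exponent the upper bound `c * b ^ (-t)` equals half of `dist ξ η`, a contradiction.
  refine ⟨-Real.logb b (dist ξ η / (2 * c)), ?_⟩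
  by_contra h
  simp only [not_eventually, not_le] at h
  have := (hc.2 ξ η x y hx hy _).2 (h.mono fun _ hp => hp.le)
  rw [neg_neg, Real.rpow_logb (by linarith) (by linarith)
    (div_pos (dist_pos.2 hne) (by linarith [hc.1]))] at this
  have h2 : c * (dist ξ η / (2 * c)) = dist ξ η / 2 := by
    field_simp [hc.1.ne']
  have := dist_pos.2 hne
  linarith

/-- Boundary points that are close have large Gromov product. -/
theorem IsVisualConst.eventually_lt (hc : IsVisualConst X b o c)
    {ξ η : GromovBoundary X} {x y : GromovSeq X} (hx : Represents x ξ)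
    (hy : Represents y η) {t : ℝ} (h : dist ξ η < c⁻¹ * b ^ (-t)) :
    ∀ᶠ p : ℕ × ℕ in atTop, t < gromovProduct (x.1 p.1) (y.1 p.2) o := by
  by_contra hn
  simp only [not_eventually, not_lt] at hn
  exact ((hc.2 ξ η x y hx hy t).1 hn).not_gt h

theorem eventually_prod {p : ℕ × ℕ → Prop} (h : ∀ᶠ q in atTop, p q) :
    ∀ᶠ n in atTop, ∀ᶠ m in atTop, p (n, m) := by
  rw [← prod_atTop_atTop_eq] at h
  exact h.curry

theorem eventually_fst {p : ℕ → Prop} (h : ∀ᶠ n in atTop, p n) :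
    ∀ᶠ q : ℕ × ℕ in atTop, p q.1 := by
  rw [← prod_atTop_atTop_eq]
  exact tendsto_fst.eventually h

theorem eventually_snd {p : ℕ → Prop} (h : ∀ᶠ n in atTop, p n) :
    ∀ᶠ q : ℕ × ℕ in atTop, p q.2 := by
  rw [← prod_atTop_atTop_eq]
  exact tendsto_snd.eventually h

/-- Shadows are closed. -/
theorem isClosed_shadow (hb : 1 < b) (hc : IsVisualConst X b o c) (x : X) (σ : ℝ) :
    IsClosed (shadow o x σ) := by
  refine isClosed_of_closure_subset fun η hη => ?_
  obtain ⟨w, hw⟩ := exists_represents η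
  -- A diagonal argument: points of `X` taken from representatives of shadow points ever closer to
  -- `η` form a new representative of `η`, and the shadow is defined by an infimum over all
  -- representatives.
  have hex : ∀ (ε : ℝ), 0 < ε → ∀ k : ℕ, ∃ v : X, gromovProduct v o x ≤ σ + ε ∧
      ∀ᶠ m in atTop, (k : ℝ) < gromovProduct v (w.1 m) o := by
    intro ε hε k
    have hpos : 0 < c⁻¹ * b ^ (-(k : ℝ)) :=
      mul_pos (inv_pos.2 hc.1) (Real.rpow_pos_of_pos (by linarith) _)
    obtain ⟨ξ, hξ, hd⟩ := Metric.mem_closure_iff.1 hη _ hpos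
    obtain ⟨z, hz, hfreq⟩ := exists_frequently_of_pointBoundaryProduct_lt
      (lt_of_le_of_lt (show pointBoundaryProduct o ξ x ≤ σ from hξ)
        (EReal.coe_lt_coe_iff.2 (by linarith : σ < σ + ε)))
    rw [dist_comm] at hd
    obtain ⟨n, hn, hn'⟩ :=
      (hfreq.and_eventually (eventually_prod (hc.eventually_lt hz hw hd))).exists
    exact ⟨z.1 n, hn.le, hn'⟩
  refine EReal.le_of_forall_lt_iff_le.1 fun t ht => ?_
  have ht' : σ < t := EReal.coe_lt_coe_iff.1 ht
  choose v hv₁ hv₂ using hex (t - σ) (by linarith)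
  obtain ⟨h, hrep⟩ := exists_represents_of_forall_eventually hw hv₂
  refine pointBoundaryProduct_le hrep (Eventually.of_forall fun n => ?_).frequently
  linarith [hv₁ n]

/-- Points of the shadow of `y` have small distance. -/
theorem dist_le_of_mem_shadow (hC : IsHypConst X C) (hb : 1 < b) (hc : IsVisualConst X b o c)
    {y : X} {σ : ℝ} {ξ η : GromovBoundary X} (hξ : ξ ∈ shadow o y σ) (hη : η ∈ shadow o y σ) :
    dist ξ η ≤ c * b ^ (σ + 1 + 2 * C) * b ^ (-dist o y) := by
  obtain ⟨x, hx⟩ := exists_represents ξ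
  obtain ⟨z, hz⟩ := exists_represents η
  rw [mul_assoc, ← Real.rpow_add (by linarith),
    show σ + 1 + 2 * C + -dist o y = -(dist o y - σ - 1 - 2 * C) by ring]
  refine (hc.2 ξ η x z hx hz _).2 (Eventually.frequently ?_)
  filter_upwards [eventually_fst (eventually_of_mem_shadow hC hx hξ),
    eventually_snd (eventually_of_mem_shadow hC hz hη)] with p h₁ h₂
  have h₃ := gromovProduct_add_swap o (x.1 p.1) y
  have h₄ := gromovProduct_add_swap o (z.1 p.2) y
  rw [gromovProduct_comm _ o] at h₁ h₂
  rw [gromovProduct_comm y] at h₃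
  exact hC.le (y := y) (by linarith) (by linarith)

theorem isBounded_shadow (hC : IsHypConst X C) (hb : 1 < b) (hc : IsVisualConst X b o c)
    (y : X) (σ : ℝ) : Bornology.IsBounded (shadow o y σ) :=
  Metric.isBounded_iff.2 ⟨_, fun _ hξ _ hη => dist_le_of_mem_shadow hC hb hc hξ hη⟩

theorem diam_shadow_le (hC : IsHypConst X C) (hb : 1 < b) (hc : IsVisualConst X b o c)
    (y : X) (σ : ℝ) :
    Metric.diam (shadow o y σ) ≤ c * b ^ (σ + 1 + 2 * C) * b ^ (-dist o y) :=
  Metric.diam_le_of_forall_dist_le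
    (mul_nonneg (mul_nonneg hc.1.le (Real.rpow_nonneg (by linarith) _))
      (Real.rpow_nonneg (by linarith) _))
    fun _ hξ _ hη => dist_le_of_mem_shadow hC hb hc hξ hη

end Boundary

/-! ### Loxodromic isometries -/

section Loxodromic

variable {X : Type*} [MetricSpace X] {C b c E : ℝ} {o : X}

/-- A point of `X` cannot be close to two distinct boundary points. -/
theorem frequently_or_frequently (hC : IsHypConst X C) {x y : ℕ → X}
    (hE : ∀ᶠ p : ℕ × ℕ in atTop, gromovProduct (x p.1) (y p.2) o ≤ E) (u : X) :
    (∃ᶠ n in atTop, gromovProduct (x n) u o ≤ E + C) ∨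
      ∃ᶠ n in atTop, gromovProduct (y n) u o ≤ E + C := by
  by_contra h
  simp only [not_or, not_frequently, not_le] at h
  obtain ⟨p, ⟨h₁, h₂⟩, h₃⟩ :=
    (((eventually_fst h.1).and (eventually_snd h.2)).and hE).exists
  rw [gromovProduct_comm (y p.2)] at h₂
  exact (hC.lt h₁ h₂).not_ge h₃

variable [HyperbolicSpace X]

/-- The translate of a boundary point `ξ` is in the shadow of `g o` if `g⁻¹ o` is not close to
`ξ`. -/
theorem boundaryMap_mem_shadow {x : GromovSeq X} {ξ : GromovBoundary X} (hx : Represents x ξ)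
    {g : X ≃ᵢ X} {σ : ℝ} (h : ∃ᶠ n in atTop, gromovProduct (x.1 n) (g.symm o) o ≤ σ) :
    boundaryMap g ξ ∈ shadow o (g o) σ := by
  refine mem_shadow_of_frequently (hx.map g) (h.mono fun n hn => ?_)
  have := gromovProduct_map_map g (x.1 n) (g.symm o) o
  rw [g.apply_symm_apply] at this
  exact this.le.trans hn

variable [MetricSpace (GromovBoundary X)]

/-- If `g ^ n ξ → p` and `g ^ n η → p` for two distinct boundary points, then `g ^ n o → p`. -/
theorem eventually_lt_of_tendsto_boundaryMap (hC : IsHypConst X C) (hb : 1 < b)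
    (hc : IsVisualConst X b o c) {g : ℕ → X ≃ᵢ X} {p ξ η : GromovBoundary X} (hne : ξ ≠ η)
    (hξ : Tendsto (fun n => boundaryMap (g n) ξ) atTop (𝓝 p))
    (hη : Tendsto (fun n => boundaryMap (g n) η) atTop (𝓝 p))
    (hg : Tendsto (fun n => dist o (g n o)) atTop atTop)
    {w : GromovSeq X} (hw : Represents w p) (t : ℝ) :
    ∀ᶠ n in atTop, ∀ᶠ j in atTop, t < gromovProduct (g n o) (w.1 j) o := by
  obtain ⟨x, hx⟩ := exists_represents ξ
  obtain ⟨y, hy⟩ := exists_represents η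
  obtain ⟨E, hE⟩ := hc.exists_bound hb hne hx hy
  -- The product of `g n o` and `g n (z i)` at `o` is `d(o, g n o)` minus the product of `(g n)⁻¹ o`
  -- and `z i`. So if `(g n)⁻¹ o` is not close to `ζ`, then `g n o` is close to the translate of
  -- `ζ`, hence to `p`. One of `ξ`, `η` always qualifies as `ζ`.
  have key : ∀ (ζ : GromovBoundary X) (z : GromovSeq X), Represents z ζ → ∀ n,
      dist (boundaryMap (g n) ζ) p < c⁻¹ * b ^ (-(t + C)) → t + E + 2 * C < dist o (g n o) →
      (∃ᶠ i in atTop, gromovProduct (z.1 i) ((g n).symm o) o ≤ E + C) →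
      ∀ᶠ j in atTop, t < gromovProduct (g n o) (w.1 j) o := by
    intro ζ z hz n hd hn hfreq
    obtain ⟨i, hi, hi'⟩ := (hfreq.and_eventually
      (eventually_prod (hc.eventually_lt (hz.map (g n)) hw hd))).exists
    refine hi'.mono fun j hj => ?_
    have h₁ : gromovProduct (g n o) (g n (z.1 i)) o = gromovProduct o (z.1 i) ((g n).symm o) :=
      gromovProduct_isometryEquiv _ _ _ _
    have h₂ := gromovProduct_add_swap o (z.1 i) ((g n).symm o)
    have h₃ : dist o ((g n).symm o) = dist o (g n o) := by
      rw [← (g n).isometry.dist_eq, (g n).apply_symm_apply, dist_comm]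
    rw [gromovProduct_comm ((g n).symm o)] at h₂
    exact hC.lt (y := g n (z.1 i)) (by linarith) hj
  have hpos : 0 < c⁻¹ * b ^ (-(t + C)) :=
    mul_pos (inv_pos.2 hc.1) (Real.rpow_pos_of_pos (by linarith) _)
  filter_upwards [hξ.eventually (Metric.ball_mem_nhds p hpos),
    hη.eventually (Metric.ball_mem_nhds p hpos), hg.eventually_gt_atTop (t + E + 2 * C)]
    with n h₁ h₂ h₃
  rcases frequently_or_frequently hC hE ((g n).symm o) with h | h
  · exact key ξ x hx n h₁ h₃ h
  · exact key η y hy n h₂ h₃ h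

/-- Sequences converging to distinct boundary points have bounded Gromov products. -/
theorem exists_bound_of_ne (hC : IsHypConst X C) (hb : 1 < b) (hc : IsVisualConst X b o c)
    {p q : GromovBoundary X} (hne : p ≠ q) {u v : ℕ → X}
    (hu : ∀ w : GromovSeq X, Represents w p → ∀ t, ∀ᶠ n in atTop, ∀ᶠ j in atTop,
      t < gromovProduct (u n) (w.1 j) o)
    (hv : ∀ w : GromovSeq X, Represents w q → ∀ t, ∀ᶠ n in atTop, ∀ᶠ j in atTop,
      t < gromovProduct (v n) (w.1 j) o) :
    ∃ K, ∀ᶠ n in atTop, gromovProduct (u n) (v n) o ≤ K := by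
  obtain ⟨x, hx⟩ := exists_represents p
  obtain ⟨y, hy⟩ := exists_represents q
  obtain ⟨E, hE⟩ := hc.exists_bound hb hne hx hy
  refine ⟨E + 2 * C, ?_⟩
  filter_upwards [hu x hx (E + 2 * C), hv y hy (E + 2 * C)] with n h₁ h₂
  obtain ⟨i, hi₁, hi₂, hi₃⟩ := (h₁.and (h₂.and (eventually_prod hE))).exists
  obtain ⟨j, hj₂, hj₃⟩ := (h₂.and hi₃).exists
  by_contra! hlt
  rw [gromovProduct_comm] at hi₁
  have h₃ : E + C < gromovProduct (u n) (y.1 j) o := hC.lt (by linarith) (by linarith)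
  exact (hC.lt (by linarith [hC.1]) h₃).not_ge hj₃

theorem IsLoxodromic.inv {g : X ≃ᵢ X} {p m : GromovBoundary X} (h : IsLoxodromic g p m) :
    IsLoxodromic g⁻¹ m p := by
  obtain ⟨h₁, h₂, h₃, h₄, h₅⟩ := h
  have key : ∀ ξ : GromovBoundary X, boundaryMap g ξ = ξ → boundaryMap g⁻¹ ξ = ξ := by
    intro ξ hξ
    conv_lhs => rw [← hξ]
    obtain ⟨x, rfl⟩ := exists_represents ξ
    refine congrArg (Quotient.mk (gromovSetoid X)) (Subtype.ext (funext fun n => ?_))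
    exact g.symm_apply_apply _
  exact ⟨h₁.symm, key _ h₃, key _ h₂, h₅, by rwa [inv_inv]⟩

theorem Attracts.tendsto {g : X ≃ᵢ X} {p m ξ : GromovBoundary X} (h : Attracts g p m)
    (hξ : ξ ≠ m) : Tendsto (fun n : ℕ => boundaryMap (g ^ n) ξ) atTop (𝓝 p) :=
  (h {ξ}ᶜ (isOpen_compl_singleton.mem_nhds hξ.symm)).tendsto_at (by simp)

theorem IsLoxodromic.not_isOfFinOrder {g : X ≃ᵢ X} {p m ξ : GromovBoundary X}
    (h : IsLoxodromic g p m) (hm : ξ ≠ m) (hp : ξ ≠ p) : ¬ IsOfFinOrder g := by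
  intro hfin
  obtain ⟨n, hn, hgn⟩ := isOfFinOrder_iff_pow_eq_one.1 hfin
  -- Along multiples of the order the iterates fix `ξ`, yet they must tend to `p`.
  have ht := (h.2.2.2.1.tendsto hm).comp (tendsto_id.const_mul_atTop' hn)
  refine hp (tendsto_nhds_unique (tendsto_const_nhds (x := ξ)) (ht.congr fun k => ?_))
  simp [pow_mul, hgn, boundaryMap_one]

/-- Infinite order makes the powers distinct, and strong discreteness lets only finitely many of
them keep `o` within a given distance. -/
theorem IsLoxodromic.tendsto_dist {g : X ≃ᵢ X} {p m ξ : GromovBoundary X}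
    (h : IsLoxodromic g p m) (hm : ξ ≠ m) (hp : ξ ≠ p) {G : Subgroup (X ≃ᵢ X)}
    (hG : IsStronglyDiscrete G o) (hg : g ∈ G) :
    Tendsto (fun n : ℕ => dist o ((g ^ n) o)) atTop atTop := by
  have hinj := injective_pow_iff_not_isOfFinOrder.2 (h.not_isOfFinOrder hm hp)
  refine tendsto_atTop.2 fun r => ?_
  have hfin := (hG (max r 1) (by positivity)).preimage (f := fun n : ℕ => g ^ n) hinj.injOn
  have := hfin.compl_mem_cofinite
  rw [Nat.cofinite_eq_atTop] at this
  filter_upwards [this] with n hn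
  by_contra! hlt
  exact hn ⟨G.pow_mem hg n, hlt.le.trans (le_max_left _ _)⟩

theorem IsLoxodromic.eventually_lt (hC : IsHypConst X C) (hb : 1 < b)
    (hc : IsVisualConst X b o c) {g : X ≃ᵢ X} {p m ξ η : GromovBoundary X}
    (h : IsLoxodromic g p m) (hne : ξ ≠ η) (hξm : ξ ≠ m) (hξp : ξ ≠ p) (hη : η ≠ m)
    {G : Subgroup (X ≃ᵢ X)} (hG : IsStronglyDiscrete G o) (hg : g ∈ G) (w : GromovSeq X)
    (hw : Represents w p) (t : ℝ) :
    ∀ᶠ n : ℕ in atTop, ∀ᶠ j in atTop, t < gromovProduct ((g ^ n) o) (w.1 j) o :=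
  eventually_lt_of_tendsto_boundaryMap hC hb hc hne (h.2.2.2.1.tendsto hξm)
    (h.2.2.2.1.tendsto hη) (h.tendsto_dist hξm hξp hG hg) hw t

/-- A strongly discrete group of general type contains four elements which are in general
position and move `o` far away. -/
theorem IsGeneralType.exists_four (hC : IsHypConst X C) (hb : 1 < b)
    (hc : IsVisualConst X b o c) {G : Subgroup (X ≃ᵢ X)} (hG : IsStronglyDiscrete G o)
    (hgen : IsGeneralType G) :
    ∃ K : ℝ, 0 ≤ K ∧ ∀ R : ℝ, ∃ f ∈ G, ∃ g ∈ G, R ≤ dist o (f o) ∧ R ≤ dist o (f⁻¹ o) ∧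
      R ≤ dist o (g o) ∧ R ≤ dist o (g⁻¹ o) ∧
      gromovProduct (f o) (f⁻¹ o) o ≤ K ∧ gromovProduct (f o) (g o) o ≤ K ∧
      gromovProduct (f o) (g⁻¹ o) o ≤ K ∧ gromovProduct (f⁻¹ o) (g o) o ≤ K ∧
      gromovProduct (f⁻¹ o) (g⁻¹ o) o ≤ K ∧ gromovProduct (g o) (g⁻¹ o) o ≤ K := by
  obtain ⟨f, hf, g, hg, p₁, m₁, p₂, m₂, h₁, h₂, hdisj⟩ := hgen
  rw [disjoint_left] at hdisj
  have hpp : p₁ ≠ p₂ := fun h => hdisj (a := p₁) (by simp) (by simp [h])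
  have hpm : p₁ ≠ m₂ := fun h => hdisj (a := p₁) (by simp) (by simp [h])
  have hmp : m₁ ≠ p₂ := fun h => hdisj (a := m₁) (by simp) (by simp [h])
  have hmm : m₁ ≠ m₂ := fun h => hdisj (a := m₁) (by simp) (by simp [h])
  have hf' := G.inv_mem hf
  have hg' := G.inv_mem hg
  have a₁ := h₁.eventually_lt hC hb hc h₂.1 (Ne.symm hmp) (Ne.symm hpp) (Ne.symm hmm) hG hf
  have a₂ := h₁.inv.eventually_lt hC hb hc h₂.1 (Ne.symm hpp) (Ne.symm hmp) (Ne.symm hpm) hG hf'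
  have a₃ := h₂.eventually_lt hC hb hc h₁.1 hpm hpp hmm hG hg
  have a₄ := h₂.inv.eventually_lt hC hb hc h₁.1 hpp hpm hmp hG hg'
  have d₁ := h₁.tendsto_dist (Ne.symm hmp) (Ne.symm hpp) hG hf
  have d₂ := h₁.inv.tendsto_dist (Ne.symm hpp) (Ne.symm hmp) hG hf'
  have d₃ := h₂.tendsto_dist hpm hpp hG hg
  have d₄ := h₂.inv.tendsto_dist hpp hpm hG hg'
  obtain ⟨K₁, k₁⟩ := exists_bound_of_ne hC hb hc h₁.1 a₁ a₂
  obtain ⟨K₂, k₂⟩ := exists_bound_of_ne hC hb hc hpp a₁ a₃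
  obtain ⟨K₃, k₃⟩ := exists_bound_of_ne hC hb hc hpm a₁ a₄
  obtain ⟨K₄, k₄⟩ := exists_bound_of_ne hC hb hc hmp a₂ a₃
  obtain ⟨K₅, k₅⟩ := exists_bound_of_ne hC hb hc hmm a₂ a₄
  obtain ⟨K₆, k₆⟩ := exists_bound_of_ne hC hb hc h₂.1 a₃ a₄
  simp only [inv_pow] at d₂ d₄ k₁ k₃ k₄ k₅ k₆
  -- The bound on the products is fixed before `R`, so that `R` may later be chosen in terms of it.
  refine ⟨|K₁| + |K₂| + |K₃| + |K₄| + |K₅| + |K₆|, by positivity, fun R => ?_⟩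
  obtain ⟨n, r₁, r₂, r₃, r₄, k₁, k₂, k₃, k₄, k₅, k₆⟩ :=
    ((d₁.eventually_ge_atTop R).and <| (d₂.eventually_ge_atTop R).and <|
      (d₃.eventually_ge_atTop R).and <| (d₄.eventually_ge_atTop R).and <|
      k₁.and <| k₂.and <| k₃.and <| k₄.and <| k₅.and k₆).exists
  have b₁ := abs_nonneg K₁
  have b₂ := abs_nonneg K₂
  have b₃ := abs_nonneg K₃
  have b₄ := abs_nonneg K₄
  have b₅ := abs_nonneg K₅
  have b₆ := abs_nonneg K₆
  have c₁ := le_abs_self K₁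
  have c₂ := le_abs_self K₂
  have c₃ := le_abs_self K₃
  have c₄ := le_abs_self K₄
  have c₅ := le_abs_self K₅
  have c₆ := le_abs_self K₆
  exact ⟨f ^ n, G.pow_mem hf n, g ^ n, G.pow_mem hg n, r₁, r₂, r₃, r₄, by linarith, by linarith,
    by linarith, by linarith, by linarith, by linarith⟩

/-- Shadows of orbit points are not too small. -/
theorem exists_le_diam_shadow (hC : IsHypConst X C) (hb : 1 < b)
    (hc : IsVisualConst X b o c) {ξ₁ ξ₂ ξ₃ : GromovBoundary X} (h₁₂ : ξ₁ ≠ ξ₂) (h₁₃ : ξ₁ ≠ ξ₃)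
    (h₂₃ : ξ₂ ≠ ξ₃) :
    ∃ a > 0, ∃ σ₁ : ℝ, ∀ σ ≥ σ₁, ∀ g : X ≃ᵢ X,
      a * b ^ (-dist o (g o)) ≤ Metric.diam (shadow o (g o) σ) := by
  obtain ⟨x₁, hx₁⟩ := exists_represents ξ₁
  obtain ⟨x₂, hx₂⟩ := exists_represents ξ₂
  obtain ⟨x₃, hx₃⟩ := exists_represents ξ₃
  obtain ⟨E₁, hE₁⟩ := hc.exists_bound hb h₁₂ hx₁ hx₂
  obtain ⟨E₂, hE₂⟩ := hc.exists_bound hb h₁₃ hx₁ hx₃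
  obtain ⟨E₃, hE₃⟩ := hc.exists_bound hb h₂₃ hx₂ hx₃
  set E := max E₁ (max E₂ E₃)
  replace hE₁ := hE₁.mono fun p hp => hp.trans (le_max_left E₁ (max E₂ E₃))
  replace hE₂ := hE₂.mono fun p hp =>
    hp.trans ((le_max_left E₂ E₃).trans (le_max_right E₁ (max E₂ E₃)))
  replace hE₃ := hE₃.mono fun p hp =>
    hp.trans ((le_max_right E₂ E₃).trans (le_max_right E₁ (max E₂ E₃)))
  have hb0 : 0 < b := by linarith
  refine ⟨c⁻¹ * b ^ (-E), mul_pos (inv_pos.2 hc.1) (Real.rpow_pos_of_pos hb0 _), E + C,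
    fun σ hσ g => ?_⟩
  have key : ∀ (ξ η : GromovBoundary X) (x y : GromovSeq X), Represents x ξ → Represents y η →
      (∀ᶠ p : ℕ × ℕ in atTop, gromovProduct (x.1 p.1) (y.1 p.2) o ≤ E) →
      (∃ᶠ n in atTop, gromovProduct (x.1 n) (g.symm o) o ≤ E + C) →
      (∃ᶠ n in atTop, gromovProduct (y.1 n) (g.symm o) o ≤ E + C) →
      c⁻¹ * b ^ (-E) * b ^ (-dist o (g o)) ≤ Metric.diam (shadow o (g o) σ) := by
    intro ξ η x y hx hy hxy h₁ h₂
    refine le_trans ?_ (Metric.dist_le_diam_of_mem (isBounded_shadow hC hb hc _ _)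
      (shadow_mono hσ (boundaryMap_mem_shadow hx h₁))
      (shadow_mono hσ (boundaryMap_mem_shadow hy h₂)))
    rw [mul_assoc, ← Real.rpow_add hb0, ← neg_add]
    refine (hc.2 _ _ _ _ (hx.map g) (hy.map g) _).1 (Eventually.frequently ?_)
    filter_upwards [hxy] with p hp
    have h₃ : dist (g.symm o) o = dist o (g o) := by
      rw [← g.isometry.dist_eq, g.apply_symm_apply]
    have h₄ := gromovProduct_le_add_dist (x.1 p.1) (y.1 p.2) (g.symm o) o
    show gromovProduct (g (x.1 p.1)) (g (y.1 p.2)) o ≤ _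
    rw [gromovProduct_isometryEquiv]
    linarith
  -- The point `g⁻¹ o` fails to be close to at least two of the three boundary points. Their
  -- translates lie in the shadow, and moving the basepoint costs at most `d(o, g o)`.
  rcases frequently_or_frequently hC hE₁ (g.symm o) with h | h
  · rcases frequently_or_frequently hC hE₃ (g.symm o) with h' | h'
    · exact key _ _ _ _ hx₁ hx₂ hE₁ h h'
    · exact key _ _ _ _ hx₁ hx₃ hE₂ h h'
  · rcases frequently_or_frequently hC hE₂ (g.symm o) with h' | h'
    · exact key _ _ _ _ hx₁ hx₂ hE₁ h' h
    · exact key _ _ _ _ hx₂ hx₃ hE₃ h h'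

end Loxodromic

/-! ### Counting orbit points -/

section Counting

variable {X : Type*} [MetricSpace X] {C b : ℝ} {o : X} {G : Subgroup (X ≃ᵢ X)}

/-- Above an exponent at which the Poincaré series diverges, some annuli contain many orbit
points. -/
theorem exists_large_annulus (hb : 1 < b) (hG : IsStronglyDiscrete G o) {s s' : ℝ} (hs : 0 ≤ s)
    (hss' : s < s') (hdiv : poincareSeries G b o s' = ∞) (A : ℝ) (N : ℕ) :
    ∃ n ≥ N, ∃ S : Finset (X ≃ᵢ X), (∀ g ∈ S, g ∈ G ∧ (n : ℝ) ≤ dist o (g o) ∧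
      dist o (g o) < n + 1) ∧ A * b ^ (s * n) ≤ S.card := by
  classical
  by_contra! hcon
  have hb0 : 0 < b := by linarith
  let d : G → ℕ := fun g => ⌊dist o ((g : X ≃ᵢ X) o)⌋₊
  have hfin : ∀ n, Finite {g : G // d g = n} := fun n => by
    have := (hG (n + 1) (by positivity)).to_subtype
    refine Finite.of_injective (β := {g : X ≃ᵢ X | g ∈ G ∧ dist o (g o) ≤ n + 1})
      (fun g => ⟨g.1.1, g.1.2, ?_⟩) fun g h hgh => ?_
    · conv_rhs => rw [← g.2]
      exact (Nat.lt_floor_add_one _).le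
    · exact Subtype.ext (Subtype.ext (congrArg (fun x => x.1) hgh))
  let _ : ∀ n, Fintype {g : G // d g = n} := fun n => Fintype.ofFinite _
  let k : ℕ → ℕ := fun n => Fintype.card {g : G // d g = n}
  have hk : ∀ n ≥ N, (k n : ℝ) < A * b ^ (s * n) := by
    intro n hn
    have hinj : Function.Injective fun g : {g : G // d g = n} => (g.1 : X ≃ᵢ X) :=
      Subtype.val_injective.comp Subtype.val_injective
    have := hcon n hn (Finset.univ.map ⟨_, hinj⟩) (by
      intro g hg
      obtain ⟨g, -, rfl⟩ := Finset.mem_map.1 hg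
      refine ⟨g.1.2, ?_, ?_⟩
      · conv_lhs => rw [← g.2]
        exact Nat.floor_le dist_nonneg
      · conv_rhs => rw [← g.2]
        exact Nat.lt_floor_add_one _)
    rwa [Finset.card_map, Finset.card_univ] at this
  -- The sum absorbs the finitely many annuli below `N`. The series at `s'` is then dominated by a
  -- geometric series of ratio `b ^ (s - s')`.
  set A' : ℝ := |A| + ∑ n ∈ Finset.range N, (k n : ℝ)
  have hA' : 0 ≤ A' := by positivity
  have hpow : ∀ n : ℕ, 1 ≤ b ^ (s * n) := fun n => Real.one_le_rpow hb.le (by positivity)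
  have hkA : ∀ n, (k n : ℝ) ≤ A' * b ^ (s * n) := by
    intro n
    rcases le_or_gt N n with hn | hn
    · refine (hk n hn).le.trans (mul_le_mul_of_nonneg_right ?_ (by positivity))
      have : 0 ≤ ∑ n ∈ Finset.range N, (k n : ℝ) := by positivity
      linarith [le_abs_self A]
    · have h₁ : (k n : ℝ) ≤ ∑ n ∈ Finset.range N, (k n : ℝ) :=
        Finset.single_le_sum (f := fun n => (k n : ℝ)) (fun _ _ => by positivity)
          (Finset.mem_range.2 hn)
      have h₂ : (k n : ℝ) ≤ A' := by linarith [abs_nonneg A]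
      exact h₂.trans (le_mul_of_one_le_right hA' (hpow n))
  have hr0 : 0 ≤ b ^ (s - s') := by positivity
  have hr1 : b ^ (s - s') < 1 := Real.rpow_lt_one_of_one_lt_of_neg hb (by linarith)
  refine absurd hdiv (ne_of_lt ?_)
  calc poincareSeries G b o s'
      = ∑' n, ∑' g : {g : G // d g = n},
          ENNReal.ofReal (b ^ (-(s' * dist o ((g.1 : X ≃ᵢ X) o)))) := by
        rw [poincareSeries, ← (Equiv.sigmaFiberEquiv d).tsum_eq, ENNReal.tsum_sigma']
        rfl
    _ ≤ ∑' n : ℕ, ENNReal.ofReal (A' * (b ^ (s - s')) ^ n) := by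
        refine ENNReal.tsum_le_tsum fun n => ?_
        have hle : ∀ g : {g : G // d g = n},
            ENNReal.ofReal (b ^ (-(s' * dist o ((g.1 : X ≃ᵢ X) o))))
              ≤ ENNReal.ofReal (b ^ (-(s' * n))) := by
          intro g
          refine ENNReal.ofReal_le_ofReal (Real.rpow_le_rpow_of_exponent_le hb.le
            (neg_le_neg (mul_le_mul_of_nonneg_left ?_ (by linarith))))
          conv_lhs => rw [← g.2]
          exact Nat.floor_le dist_nonneg
        refine (ENNReal.tsum_le_tsum hle).trans ?_
        rw [tsum_fintype, Finset.sum_const, Finset.card_univ, nsmul_eq_mul,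
          ← ENNReal.ofReal_natCast, ← ENNReal.ofReal_mul (by positivity)]
        refine ENNReal.ofReal_le_ofReal ?_
        refine (mul_le_mul_of_nonneg_right (hkA n) (by positivity)).trans_eq ?_
        rw [mul_assoc, ← Real.rpow_add hb0, ← Real.rpow_natCast (b ^ (s - s')), ← Real.rpow_mul hb0.le]
        ring_nf
    _ < ∞ := by
        have hsum := (summable_geometric_of_lt_one hr0 hr1).mul_left A'
        rw [← ENNReal.ofReal_tsum_of_nonneg (fun n => by positivity) hsum]
        exact ENNReal.ofReal_lt_top

/-- A finite set of group elements contains a proportion of elements moving `o` to points that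
are far apart from each other. -/
theorem exists_separated_subset (hG : IsStronglyDiscrete G o) (M : ℝ) :
    ∃ N : ℕ, ∀ S : Finset (X ≃ᵢ X), (∀ g ∈ S, g ∈ G) → ∃ S' ⊆ S, S.card ≤ S'.card * N ∧
      ∀ f ∈ S', ∀ g ∈ S', f ≠ g → M ≤ dist (f o) (g o) := by
  classical
  have hfin := hG (max M 1) (by positivity)
  refine ⟨hfin.toFinset.card, fun S hS => ?_⟩
  -- By maximality every `g` in `S` moves `o` close to some `f o` with `f` in `S'`. Then `f⁻¹ * g`
  -- lies in a finite set depending only on `M`, which bounds how many `g` belong to one `f`.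
  obtain ⟨S', hS', hmax⟩ := Finset.exists_max_image (S.powerset.filter fun F =>
    ∀ f ∈ F, ∀ g ∈ F, f ≠ g → M ≤ dist (f o) (g o)) Finset.card ⟨∅, by simp⟩
  simp only [Finset.mem_filter, Finset.mem_powerset] at hS' hmax
  refine ⟨S', hS'.1, ?_, hS'.2⟩
  have hcover : S ⊆ S'.biUnion fun f => S.filter fun g => dist (f o) (g o) ≤ max M 1 := by
    intro g hg
    by_contra hn
    simp only [Finset.mem_biUnion, Finset.mem_filter, hg, true_and, not_exists, not_and,
      not_le] at hn
    have hgS' : g ∉ S' := fun h => by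
      have := hn g h
      rw [dist_self] at this
      exact absurd this (not_lt.2 (by positivity))
    have hlt : ∀ f ∈ S', M ≤ dist (f o) (g o) := fun f hf => (le_max_left _ _).trans (hn f hf).le
    have := hmax (insert g S') ⟨Finset.insert_subset hg hS'.1, by
      intro f hf f' hf' hne
      rcases Finset.mem_insert.1 hf with h₁ | h₁ <;> rcases Finset.mem_insert.1 hf' with h₂ | h₂
      · exact absurd (h₁.trans h₂.symm) hne
      · rw [h₁, dist_comm]
        exact hlt _ h₂
      · rw [h₂]
        exact hlt _ h₁
      · exact hS'.2 f h₁ f' h₂ hne⟩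
    rw [Finset.card_insert_of_notMem hgS'] at this
    omega
  refine (Finset.card_le_card hcover).trans (Finset.card_biUnion_le_card_mul _ _ _ fun f hf => ?_)
  refine Finset.card_le_card_of_injOn (fun g => f⁻¹ * g) (fun g hg => ?_)
    fun g _ h _ hgh => mul_left_cancel hgh
  have hg := Finset.mem_filter.1 hg
  simp only [Finite.coe_toFinset, mem_ofPred_eq]
  refine ⟨G.mul_mem (G.inv_mem (hS f (hS'.1 hf))) (hS g hg.1), ?_⟩
  rw [← f.isometry.dist_eq]
  convert hg.2 using 2
  exact f.apply_symm_apply _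

/-- One of two elements `f`, `g` with distinct repelling directions moves at least half of a
given finite set of group elements into its attracting direction. -/
theorem exists_redirect (hC : IsHypConst X C) {K R L M n : ℝ} {f g : X ≃ᵢ X} (hf : f ∈ G)
    (hg : g ∈ G) (hfg : gromovProduct (f⁻¹ o) (g⁻¹ o) o ≤ K) (hfR : R ≤ dist o (f o))
    (hgR : R ≤ dist o (g o)) (hfL : dist o (f o) ≤ L) (hgL : dist o (g o) ≤ L)
    {S : Finset (X ≃ᵢ X)} (hS : ∀ h ∈ S, h ∈ G ∧ n ≤ dist o (h o) ∧ dist o (h o) < n + 1)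
    (hM : ∀ h ∈ S, ∀ h' ∈ S, h ≠ h' → M ≤ dist (h o) (h' o)) {N : ℕ} (hN : 2 * N ≤ S.card) :
    ∃ p, (p = f o ∨ p = g o) ∧ ∃ F : ℕ → X ≃ᵢ X, ∀ a < N, F a ∈ G ∧ n - L ≤ dist o (F a o) ∧
      dist o (F a o) ≤ n + 1 + L ∧ R - K - C ≤ gromovProduct p (F a o) o ∧
      ∀ a' < N, a ≠ a' → M ≤ dist (F a o) (F a' o) := by
  classical
  have key : ∀ h : X ≃ᵢ X, h ∈ G → R ≤ dist o (h o) → dist o (h o) ≤ L → ∀ S' ⊆ S, N ≤ S'.card →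
      (∀ h' ∈ S', gromovProduct (h⁻¹ o) (h' o) o ≤ K + C) →
      ∃ F : ℕ → X ≃ᵢ X, ∀ a < N, F a ∈ G ∧ n - L ≤ dist o (F a o) ∧
      dist o (F a o) ≤ n + 1 + L ∧ R - K - C ≤ gromovProduct (h o) (F a o) o ∧
      ∀ a' < N, a ≠ a' → M ≤ dist (F a o) (F a' o) := by
    intro h hh hR hL S' hS' hcard hdir
    -- An enumeration of `S'`; the default value `1` is never reached for `a < N`.
    let e : ℕ → X ≃ᵢ X := fun a => if ha : a < S'.card then S'.equivFin.symm ⟨a, ha⟩ else 1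
    have he : ∀ a < N, e a ∈ S' := fun a ha => by
      simp only [e, dif_pos (ha.trans_le hcard)]
      exact Subtype.coe_prop _
    have hinj : ∀ a < N, ∀ a' < N, a ≠ a' → e a ≠ e a' := fun a ha a' ha' hne heq => by
      simp only [e, dif_pos (ha.trans_le hcard), dif_pos (ha'.trans_le hcard)] at heq
      simpa [hne] using Subtype.ext heq
    refine ⟨fun a => h * e a, fun a ha => ?_⟩
    obtain ⟨h₁, h₂, h₃⟩ := hS _ (hS' (he a ha))
    have hd : dist (h o) ((h * e a) o) = dist o (e a o) := h.isometry.dist_eq _ _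
    have hgp : gromovProduct o ((h * e a) o) (h o) = gromovProduct (h⁻¹ o) (e a o) o := by
      rw [← gromovProduct_map_map h (h⁻¹ o)]
      congr 1
      exact (h.apply_symm_apply o).symm
    refine ⟨G.mul_mem hh h₁, ?_, ?_, ?_, fun a' ha' hne => ?_⟩
    · have := dist_triangle_left (h o) ((h * e a) o) o
      linarith
    · have := dist_triangle o (h o) ((h * e a) o)
      linarith
    · have h₄ := gromovProduct_add_swap (h o) ((h * e a) o) o
      rw [hgp, dist_comm] at h₄
      linarith [hdir _ (he a ha)]
    · refine (hM _ (hS' (he a ha)) _ (hS' (he a' ha')) (hinj a ha a' ha' hne)).trans_eq ?_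
      exact (h.isometry.dist_eq _ _).symm
  -- An `h o` close to `f⁻¹ o` is not close to `g⁻¹ o`. Hence either half of `S` avoids the
  -- repelling direction of `f`, or half of it avoids that of `g`.
  by_cases hcard : N ≤ (S.filter fun h => gromovProduct (f⁻¹ o) (h o) o ≤ K + C).card
  · obtain ⟨F, hF⟩ := key f hf hfR hfL _ (Finset.filter_subset _ _) hcard
      fun h hh => (Finset.mem_filter.1 hh).2
    exact ⟨f o, Or.inl rfl, F, hF⟩
  · have hsplit := Finset.card_filter_add_card_filter_not (s := S)
      (fun h : X ≃ᵢ X => gromovProduct (f⁻¹ o) (h o) o ≤ K + C)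
    obtain ⟨F, hF⟩ := key g hg hgR hgL
      (S.filter fun h => ¬ gromovProduct (f⁻¹ o) (h o) o ≤ K + C) (Finset.filter_subset _ _)
      (by omega) fun h hh => by
        have hlt := not_le.1 (Finset.mem_filter.1 hh).2
        by_contra! hlt'
        rw [gromovProduct_comm (g⁻¹ o)] at hlt'
        exact (hC.lt hlt hlt').not_ge hfg
    exact ⟨g o, Or.inr rfl, F, hF⟩

/-- The orbit of `o` as a set. -/
def orbitSet (G : Subgroup (X ≃ᵢ X)) (o : X) : Set X := {y | ∃ g ∈ G, y = g o}

/-- From each orbit point `x` one can continue, away from `o`, to many orbit points that are far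
apart from each other, at a roughly constant distance from `x`. -/
theorem exists_children (hC : IsHypConst X C) (hb : 1 < b) (hG : IsStronglyDiscrete G o)
    {K : ℝ}
    (hfour : ∀ R : ℝ, ∃ f ∈ G, ∃ g ∈ G, R ≤ dist o (f o) ∧ R ≤ dist o (f⁻¹ o) ∧
      R ≤ dist o (g o) ∧ R ≤ dist o (g⁻¹ o) ∧
      gromovProduct (f o) (f⁻¹ o) o ≤ K ∧ gromovProduct (f o) (g o) o ≤ K ∧
      gromovProduct (f o) (g⁻¹ o) o ≤ K ∧ gromovProduct (f⁻¹ o) (g o) o ≤ K ∧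
      gromovProduct (f⁻¹ o) (g⁻¹ o) o ≤ K ∧ gromovProduct (g o) (g⁻¹ o) o ≤ K)
    {s s' : ℝ} (hs : 0 ≤ s) (hss' : s < s') (hdiv : poincareSeries G b o s' = ∞) :
    ∃ L : ℝ, 0 ≤ L ∧ ∀ (M A : ℝ) (N₀ : ℕ), ∃ n ≥ N₀, ∃ N : ℕ, A * b ^ (s * n) ≤ N ∧
      ∃ child : X → ℕ → X, ∀ x ∈ orbitSet G o, ∀ a < N, child x a ∈ orbitSet G o ∧
        n - L ≤ dist x (child x a) ∧ dist x (child x a) ≤ n + 1 + L ∧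
        gromovProduct o (child x a) x ≤ K + 3 * C ∧
        ∀ a' < N, a ≠ a' → M ≤ dist (child x a) (child x a') := by
  -- With this `R` the redirected points have product at least `R - K - C = K + 3 * C + 1` with
  -- their direction, which leaves room for three uses of the hyperbolic inequality. The loss `L`
  -- depends only on `f` and `g`, not on `M`, `A` or `n`.
  obtain ⟨f, hf, g, hg, hf₁, hf₂, hg₁, hg₂, h₁, h₂, h₃, h₄, h₅, h₆⟩ := hfour (2 * K + 4 * C + 1)
  set L := dist o (f o) + dist o (f⁻¹ o) + dist o (g o) + dist o (g⁻¹ o)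
  have e₁ := dist_nonneg (x := o) (y := f o)
  have e₂ := dist_nonneg (x := o) (y := f⁻¹ o)
  have e₃ := dist_nonneg (x := o) (y := g o)
  have e₄ := dist_nonneg (x := o) (y := g⁻¹ o)
  refine ⟨L, by positivity, fun M A N₀ => ?_⟩
  obtain ⟨N₁, hN₁⟩ := exists_separated_subset hG M
  -- The factor `N₁` pays for the separation and `2` for the redirection; `|A| + 1` covers the
  -- ceiling and the final `1` gives strictness.
  obtain ⟨n, hn, S, hS, hcard⟩ := exists_large_annulus hb hG hs hss' hdiv
    (N₁ * (2 * (|A| + 1)) + 1) N₀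
  obtain ⟨S', hS', hcard', hsep⟩ := hN₁ S fun g hg => (hS g hg).1
  set N := ⌈A * b ^ (s * n)⌉₊
  have hpow : 1 ≤ b ^ (s * n) := Real.one_le_rpow hb.le (by positivity)
  have hN : 2 * N ≤ S'.card := by
    have hN' : (N : ℝ) ≤ (|A| + 1) * b ^ (s * n) := by
      have : A * b ^ (s * n) ≤ |A| * b ^ (s * n) :=
        mul_le_mul_of_nonneg_right (le_abs_self A) (by linarith)
      have h0 : 0 ≤ |A| * b ^ (s * n) := by positivity
      have := Nat.ceil_lt_add_one h0
      have hle : (N : ℝ) ≤ ⌈|A| * b ^ (s * n)⌉₊ := by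
        exact_mod_cast Nat.ceil_le_ceil ‹A * b ^ (s * n) ≤ |A| * b ^ (s * n)›
      linarith
    have hc : (S.card : ℝ) ≤ S'.card * N₁ := by exact_mod_cast hcard'
    by_contra! hlt
    have hlt' : (S'.card : ℝ) ≤ 2 * N := by exact_mod_cast hlt.le
    have : (S'.card : ℝ) * N₁ ≤ 2 * ((|A| + 1) * b ^ (s * n)) * N₁ :=
      mul_le_mul_of_nonneg_right (by linarith) (by positivity)
    linarith
  obtain ⟨p, hp, F, hF⟩ := exists_redirect (L := L) hC hf hg h₅ hf₁ hg₁ (by linarith) (by linarith)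
    (fun h hh => hS h (hS' hh)) hsep hN
  obtain ⟨q, hq, F', hF'⟩ := exists_redirect (K := K) (L := L) hC (G.inv_mem hf) (G.inv_mem hg)
    (by simpa using h₂) hf₂ hg₂ (by linarith) (by linarith)
    (fun h hh => hS h (hS' hh)) hsep hN
  have hpq : gromovProduct p q o ≤ K := by
    rcases hp with rfl | rfl <;> rcases hq with rfl | rfl
    · exact h₁
    · exact h₃
    · rwa [gromovProduct_comm]
    · exact h₆
  refine ⟨n, hn, N, Nat.le_ceil _, ?_⟩
  have hex : ∀ x, ∃ ch : ℕ → X, x ∈ orbitSet G o → ∀ a < N, ch a ∈ orbitSet G o ∧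
        n - L ≤ dist x (ch a) ∧ dist x (ch a) ≤ n + 1 + L ∧
        gromovProduct o (ch a) x ≤ K + 3 * C ∧
        ∀ a' < N, a ≠ a' → M ≤ dist (ch a) (ch a') := by
    intro x
    by_cases hx : x ∈ orbitSet G o
    swap
    · exact ⟨fun _ => o, fun h => absurd h hx⟩
    obtain ⟨γ, hγ, rfl⟩ := hx
    have key : ∀ (p : X) (F : ℕ → X ≃ᵢ X), (∀ a < N, F a ∈ G ∧ n - L ≤ dist o (F a o) ∧
        dist o (F a o) ≤ n + 1 + L ∧ 2 * K + 4 * C + 1 - K - C ≤ gromovProduct p (F a o) o ∧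
        ∀ a' < N, a ≠ a' → M ≤ dist (F a o) (F a' o)) →
        (∀ a < N, gromovProduct (γ.symm o) (F a o) o ≤ K + 3 * C) →
        ∃ ch : ℕ → X, γ o ∈ orbitSet G o → ∀ a < N, ch a ∈ orbitSet G o ∧
          n - L ≤ dist (γ o) (ch a) ∧ dist (γ o) (ch a) ≤ n + 1 + L ∧
          gromovProduct o (ch a) (γ o) ≤ K + 3 * C ∧
          ∀ a' < N, a ≠ a' → M ≤ dist (ch a) (ch a') := by
      intro p F hF hz
      refine ⟨fun a => γ (F a o), fun _ a ha => ?_⟩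
      obtain ⟨i₁, i₂, i₃, -, i₅⟩ := hF a ha
      simp only [γ.isometry.dist_eq]
      refine ⟨⟨γ * F a, G.mul_mem hγ i₁, rfl⟩, i₂, i₃, ?_, i₅⟩
      have := gromovProduct_map_map γ (γ.symm o) (F a o) o
      rw [γ.apply_symm_apply] at this
      exact this.le.trans (hz a ha)
    -- If some child in direction `p` is too close to `γ⁻¹ o`, then `γ⁻¹ o` is close to `p`. A child
    -- in direction `q` that is also too close would force the product of `p` and `q` above `K`. So
    -- one of the two families works as a whole.
    by_cases hz : ∀ a < N, gromovProduct (γ.symm o) (F a o) o ≤ K + 3 * C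
    · exact key p F hF hz
    refine key q F' hF' fun a' ha' => ?_
    push Not at hz
    obtain ⟨a, ha, hz⟩ := hz
    by_contra! hz'
    obtain ⟨-, -, -, i₄, -⟩ := hF a ha
    obtain ⟨-, -, -, j₄, -⟩ := hF' a' ha'
    rw [gromovProduct_comm] at hz j₄
    have k₁ : K + 2 * C < gromovProduct p (γ.symm o) o :=
      hC.lt (y := F a o) (by linarith) (by linarith)
    have k₂ : K + C < gromovProduct p (F' a' o) o := hC.lt (by linarith) (by linarith [hC.1])
    exact (hC.lt k₂ (by linarith [hC.1])).not_ge hpq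
  choose child hchild using hex
  exact ⟨child, hchild⟩

end Counting

/-! ### Weighted trees and interval codings -/

section WeightedTree

theorem initialSegment_zero (ω : ℕ → ℕ) : initialSegment ω 0 = [] := rfl

theorem initialSegment_succ (ω : ℕ → ℕ) (n : ℕ) :
    initialSegment ω (n + 1) = initialSegment ω n ++ [ω n] := by
  simp [initialSegment, List.range_succ]

theorem length_initialSegment (ω : ℕ → ℕ) (n : ℕ) : (initialSegment ω n).length = n := by
  simp [initialSegment]

/-- A tree in which `ω` has `k ω` children, with a mass which is distributed equally among the
children of each vertex. -/
structure IsWeightedTree (T : Set (List ℕ)) (k : List ℕ → ℕ) (m : List ℕ → ℝ) : Prop where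
  nil_mem : [] ∈ T
  append_mem_iff : ∀ ω a, ω ++ [a] ∈ T ↔ ω ∈ T ∧ a < k ω
  k_pos : ∀ ω ∈ T, 0 < k ω
  m_pos : ∀ ω ∈ T, 0 < m ω
  m_append : ∀ ω ∈ T, ∀ a < k ω, m (ω ++ [a]) = m ω / k ω

/-- The left endpoint of the interval coded by a word. -/
noncomputable def leftEndpoint (m : List ℕ → ℝ) (ω : List ℕ) : ℝ :=
  ∑ i ∈ Finset.range ω.length, (ω.getD i 0 : ℝ) * m (ω.take (i + 1))

theorem leftEndpoint_append (m : List ℕ → ℝ) (ω : List ℕ) (a : ℕ) :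
    leftEndpoint m (ω ++ [a]) = leftEndpoint m ω + a * m (ω ++ [a]) := by
  unfold leftEndpoint
  rw [List.length_append, List.length_singleton, Finset.sum_range_succ]
  congr 1
  · refine Finset.sum_congr rfl fun i hi => ?_
    have hi' := Finset.mem_range.1 hi
    rw [List.getD_append _ _ _ _ hi', List.take_append_of_le_length (by omega)]
  · rw [List.take_of_length_le (by simp)]
    simp

/-- The interval coded by a word. -/
noncomputable def codeInterval (m : List ℕ → ℝ) (ω : List ℕ) : Set ℝ :=
  Ico (leftEndpoint m ω) (leftEndpoint m ω + m ω)

theorem measurableSet_codeInterval (m : List ℕ → ℝ) (ω : List ℕ) :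
    MeasurableSet (codeInterval m ω) := measurableSet_Ico

/-- The letter following `ω` in the coding of `t`. -/
noncomputable def nextLetter (k : List ℕ → ℕ) (m : List ℕ → ℝ) (ω : List ℕ) (t : ℝ) : ℕ :=
  ⌊(t - leftEndpoint m ω) / (m ω / k ω)⌋₊

/-- The coding of `t` by words of length `n`. -/
noncomputable def codeWord (k : List ℕ → ℕ) (m : List ℕ → ℝ) : ℕ → ℝ → List ℕ
  | 0, _ => []
  | n + 1, t => codeWord k m n t ++ [nextLetter k m (codeWord k m n t) t]

variable {T : Set (List ℕ)} {k : List ℕ → ℕ} {m : List ℕ → ℝ}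

theorem initialSegment_nextLetter (t : ℝ) (n : ℕ) :
    initialSegment (fun i => nextLetter k m (codeWord k m i t) t) n = codeWord k m n t := by
  induction n with
  | zero => rfl
  | succ n ih => rw [initialSegment_succ, ih, codeWord]

theorem measurableSet_codeWord_eq (n : ℕ) (ω : List ℕ) :
    MeasurableSet {t | codeWord k m n t = ω} := by
  induction n generalizing ω with
  | zero => simp [codeWord]
  | succ n ih =>
    rcases List.eq_nil_or_concat' ω with rfl | ⟨τ, a, rfl⟩
    · simp [codeWord]
    · have : {t | codeWord k m (n + 1) t = τ ++ [a]} =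
          {t | codeWord k m n t = τ} ∩ nextLetter k m τ ⁻¹' {a} := by
        ext t
        simp only [codeWord, mem_ofPred_eq, mem_inter_iff, mem_preimage, mem_singleton_iff,
          List.concat_inj, ← List.concat_eq_append]
        constructor
        · rintro ⟨h₁, h₂⟩
          exact ⟨h₁, h₁ ▸ h₂⟩
        · rintro ⟨h₁, h₂⟩
          exact ⟨h₁, h₁ ▸ h₂⟩
      rw [this]
      refine (ih τ).inter (Measurable.comp Nat.measurable_floor ?_ (measurableSet_singleton a))
      fun_prop

namespace IsWeightedTree

theorem mem_of_append_mem (h : IsWeightedTree T k m) {ω : List ℕ} {a : ℕ} (hω : ω ++ [a] ∈ T) :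
    ω ∈ T := ((h.append_mem_iff ω a).1 hω).1

/-- The children of `ω` cut its half-open interval into `k ω` adjacent pieces of equal length, and
the floor function reads off the piece. Half-openness makes the coding unambiguous. -/
theorem mem_codeInterval_append_iff (h : IsWeightedTree T k m) {ω : List ℕ} {a : ℕ}
    (hω : ω ++ [a] ∈ T) {t : ℝ} :
    t ∈ codeInterval m (ω ++ [a]) ↔ t ∈ codeInterval m ω ∧ nextLetter k m ω t = a := by
  obtain ⟨hωT, ha⟩ := (h.append_mem_iff ω a).1 hω
  have hk : (0 : ℝ) < k ω := by exact_mod_cast h.k_pos ω hωT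
  have hpos : 0 < m ω / k ω := div_pos (h.m_pos ω hωT) hk
  have hmk : m ω = k ω * (m ω / k ω) := by field_simp
  have hak : (a : ℝ) + 1 ≤ k ω := by exact_mod_cast ha
  simp only [codeInterval, leftEndpoint_append, h.m_append ω hωT a ha, mem_Ico, nextLetter]
  constructor
  · rintro ⟨h₁, h₂⟩
    have h₃ : 0 ≤ a * (m ω / k ω) := by positivity
    have h₄ := mul_le_mul_of_nonneg_right hak hpos.le
    refine ⟨⟨by linarith, by linarith⟩, ?_⟩
    rw [Nat.floor_eq_iff (div_nonneg (by linarith) hpos.le), le_div_iff₀ hpos, div_lt_iff₀ hpos]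
    constructor <;> linarith
  · rintro ⟨⟨h₁, h₂⟩, h₃⟩
    rw [Nat.floor_eq_iff (div_nonneg (by linarith) hpos.le), le_div_iff₀ hpos,
      div_lt_iff₀ hpos] at h₃
    constructor <;> linarith [h₃.1, h₃.2]

theorem nextLetter_lt (h : IsWeightedTree T k m) {ω : List ℕ} (hω : ω ∈ T) {t : ℝ}
    (ht : t ∈ codeInterval m ω) : nextLetter k m ω t < k ω := by
  have hk : (0 : ℝ) < k ω := by exact_mod_cast h.k_pos ω hω
  have hpos : 0 < m ω / k ω := div_pos (h.m_pos ω hω) hk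
  have hmk : m ω = k ω * (m ω / k ω) := by field_simp
  rw [nextLetter, Nat.floor_lt (div_nonneg (by linarith [ht.1]) hpos.le), div_lt_iff₀ hpos]
  linarith [ht.2]

theorem codeInterval_subset_nil (h : IsWeightedTree T k m) {ω : List ℕ} (hω : ω ∈ T) :
    codeInterval m ω ⊆ codeInterval m [] := by
  induction ω using List.reverseRecOn with
  | nil => exact Subset.rfl
  | append_singleton ω a ih =>
    intro t ht
    exact ih (h.mem_of_append_mem hω) ((h.mem_codeInterval_append_iff hω).1 ht).1

theorem codeWord_mem (h : IsWeightedTree T k m) {t : ℝ} (ht : t ∈ codeInterval m []) (n : ℕ) :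
    codeWord k m n t ∈ T ∧ t ∈ codeInterval m (codeWord k m n t) := by
  induction n with
  | zero => exact ⟨h.nil_mem, ht⟩
  | succ n ih =>
    have hmem := (h.append_mem_iff _ _).2 ⟨ih.1, h.nextLetter_lt ih.1 ih.2⟩
    exact ⟨hmem, (h.mem_codeInterval_append_iff hmem).2 ⟨ih.2, rfl⟩⟩

theorem codeWord_eq (h : IsWeightedTree T k m) {ω : List ℕ} (hω : ω ∈ T) {t : ℝ}
    (ht : t ∈ codeInterval m ω) : codeWord k m ω.length t = ω := by
  induction ω using List.reverseRecOn with
  | nil => rfl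
  | append_singleton ω a ih =>
    obtain ⟨h₁, h₂⟩ := (h.mem_codeInterval_append_iff hω).1 ht
    rw [List.length_append, List.length_singleton, codeWord, ih (h.mem_of_append_mem hω) h₁, h₂]

theorem finite_level (h : IsWeightedTree T k m) (n : ℕ) : {ω ∈ T | ω.length = n}.Finite := by
  induction n with
  | zero => exact (finite_singleton []).subset fun ω hω => List.length_eq_zero_iff.1 hω.2
  | succ n ih =>
    refine (ih.biUnion fun ω _ => (finite_Iio (k ω)).image fun a => ω ++ [a]).subset fun ω hω => ?_
    rcases List.eq_nil_or_concat' ω with rfl | ⟨τ, a, rfl⟩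
    · simp at hω
    · obtain ⟨h₁, h₂⟩ := (h.append_mem_iff τ a).1 hω.1
      exact mem_biUnion (x := τ) ⟨h₁, by simpa using hω.2⟩ ⟨a, h₂, rfl⟩

end IsWeightedTree

end WeightedTree

/-! ### Partition structures -/

section Partition

variable {Z : Type*} [MetricSpace Z] {T : Set (List ℕ)} {P : List ℕ → Set Z}

namespace IsPartitionStructure

theorem eq_of_mem (h : IsPartitionStructure T P) {ω τ : List ℕ} (hω : ω ∈ T) (hτ : τ ∈ T)
    (hlen : ω.length = τ.length) {z : Z} (hzω : z ∈ P ω) (hzτ : z ∈ P τ) : ω = τ := by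
  by_contra hne
  exact (h.disjoint ω hω τ hτ (fun hp => hne (hp.eq_of_length hlen))
    fun hp => hne (hp.eq_of_length hlen.symm).symm).le_bot ⟨hzω, hzτ⟩

theorem nonempty (h : IsPartitionStructure T P) {ω : List ℕ} (hω : ω ∈ T) : (P ω).Nonempty := by
  by_contra hn
  have := h.diam_pos ω hω
  rw [not_nonempty_iff_eq_empty.1 hn, Metric.diam_empty] at this
  exact lt_irrefl _ this

theorem diam_strictAnti (h : IsPartitionStructure T P) {ω τ : List ℕ} (hτ : τ ∈ T)
    (hpre : ω <+: τ) (hne : ω ≠ τ) : Metric.diam (P τ) < Metric.diam (P ω) := by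
  obtain ⟨κ, lam, -, -, hlam, hgeo⟩ := h.geometry
  induction τ using List.reverseRecOn with
  | nil => exact absurd (List.prefix_nil.1 hpre) hne
  | append_singleton τ a ih =>
    have hτT : τ ∈ T := h.isTree.2 _ _ (List.prefix_append _ _) hτ
    have hlt : Metric.diam (P (τ ++ [a])) < Metric.diam (P τ) :=
      (hgeo τ a hτT hτ).2.2.trans_lt (mul_lt_of_lt_one_left (h.diam_pos τ hτT) hlam)
    rcases List.prefix_concat_iff.1 hpre with heq | hpre'
    · exact absurd heq hne
    · by_cases heq : ω = τ
      · rwa [heq]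
      · exact hlt.trans (ih hτT hpre' heq)

/-- Comparable words have pieces of different diameters, and incomparable words have disjoint
nonempty pieces. For shadows this makes the labelling by orbit points injective. -/
theorem injOn (h : IsPartitionStructure T P) : InjOn P T := by
  intro ω hω τ hτ heq
  by_contra hne
  by_cases h₁ : ω <+: τ
  · exact (h.diam_strictAnti hτ h₁ hne).ne (congrArg _ heq.symm)
  by_cases h₂ : τ <+: ω
  · exact (h.diam_strictAnti hω h₂ (Ne.symm hne)).ne (congrArg _ heq)
  have hd := h.disjoint ω hω τ hτ h₁ h₂
  obtain ⟨z, hz⟩ := h.nonempty hω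
  exact hd.le_bot ⟨hz, heq ▸ hz⟩

theorem diam_initialSegment_le {ω : ℕ → ℕ} {lam : ℝ} (hlam : 0 ≤ lam)
    (hgeo : ∀ n, Metric.diam (P (initialSegment ω (n + 1))) ≤
      lam * Metric.diam (P (initialSegment ω n))) (n : ℕ) :
    Metric.diam (P (initialSegment ω n)) ≤ lam ^ n * Metric.diam (P []) := by
  induction n with
  | zero => simp [initialSegment_zero]
  | succ n ih =>
    refine (hgeo n).trans ((mul_le_mul_of_nonneg_left ih hlam).trans_eq ?_)
    ring

/-- The limit set of a partition structure on a finitely branching tree is closed. -/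
theorem isClosed_partitionLimitSet (h : IsPartitionStructure T P)
    (hfin : ∀ n, {ω ∈ T | ω.length = n}.Finite) : IsClosed (partitionLimitSet T P) := by
  -- A point in some piece of every level determines those pieces, since pieces of one level are
  -- disjoint; nestedness makes the words extend each other and form a branch.
  have : partitionLimitSet T P = ⋂ n, ⋃ ω ∈ {ω ∈ T | ω.length = n}, P ω := by
    ext z
    simp only [mem_iInter, mem_iUnion, partitionLimitSet, mem_ofPred_eq]
    constructor
    · rintro ⟨ω, hω⟩ n
      exact ⟨_, ⟨(hω n).1, length_initialSegment ω n⟩, (hω n).2⟩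
    · intro hz
      choose W hW hzW using hz
      have hsucc : ∀ n, ∃ a, W (n + 1) = W n ++ [a] := by
        intro n
        rcases List.eq_nil_or_concat' (W (n + 1)) with heq | ⟨τ, a, heq⟩
        · have := (hW (n + 1)).2
          simp [heq] at this
        · have hτ : τ ∈ T := h.isTree.2 _ _ (heq ▸ List.prefix_append _ _) (hW (n + 1)).1
          have hlen := (hW (n + 1)).2
          rw [heq, List.length_append, List.length_singleton] at hlen
          have hzτ := h.nested τ hτ _ (hW (n + 1)).1 (heq ▸ List.prefix_append _ _) (hzW (n + 1))
          have := h.eq_of_mem hτ (hW n).1 (by rw [(hW n).2]; omega) hzτ (hzW n)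
          exact ⟨a, this ▸ heq⟩
      choose ω hω using hsucc
      have hWω : ∀ n, initialSegment ω n = W n := by
        intro n
        induction n with
        | zero => exact (List.length_eq_zero_iff.1 (hW 0).2).symm
        | succ n ih => rw [initialSegment_succ, ih, hω]
      exact ⟨ω, fun n => by rw [hWω]; exact ⟨(hW n).1, hzW n⟩⟩
  rw [this]
  exact isClosed_iInter fun n => (hfin n).isClosed_biUnion fun ω hω => h.isClosed ω hω.1

/-- The masses of a weighted tree are realized by a measure on the limit set. -/
theorem exists_measure [MeasurableSpace Z] [BorelSpace Z] (h : IsPartitionStructure T P)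
    {k : List ℕ → ℕ} {m : List ℕ → ℝ} (hT : IsWeightedTree T k m)
    (hne : ∀ ω : ℕ → ℕ, (∀ n, initialSegment ω n ∈ T) → ∃ z, ∀ n, z ∈ P (initialSegment ω n)) :
    ∃ μ : Measure Z, IsFiniteMeasure μ ∧ μ (partitionLimitSet T P)ᶜ = 0 ∧
      μ univ = ENNReal.ofReal (m []) ∧ ∀ ω ∈ T, μ (P ω) = ENNReal.ofReal (m ω) := by
  classical
  have hex : ∀ t : ℝ, ∃ z, t ∈ codeInterval m [] → ∀ n, z ∈ P (codeWord k m n t) := by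
    intro t
    by_cases ht : t ∈ codeInterval m []
    · obtain ⟨z, hz⟩ := hne (fun i => nextLetter k m (codeWord k m i t) t) fun n => by
        rw [initialSegment_nextLetter]
        exact (hT.codeWord_mem ht n).1
      exact ⟨z, fun _ n => by simpa only [initialSegment_nextLetter] using hz n⟩
    · exact ⟨(h.nonempty hT.nil_mem).some, fun h => absurd h ht⟩
  -- The map `φ` is merely chosen. Its almost everywhere measurability comes from being the
  -- pointwise limit, on the coding interval, of maps that depend only on a finite code word.
  choose φ hφ using hex
  have hz : ∀ ω, ∃ z, ω ∈ T → z ∈ P ω := fun ω => by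
    by_cases hω : ω ∈ T
    · exact ⟨(h.nonempty hω).some, fun _ => (h.nonempty hω).some_mem⟩
    · exact ⟨(h.nonempty hT.nil_mem).some, fun h => absurd h hω⟩
  choose z hz using hz
  obtain ⟨κ, lam, -, hlam0, hlam1, hgeo⟩ := h.geometry
  have hmeas : ∀ n, Measurable fun t => z (codeWord k m n t) := by
    intro n A _
    have : (fun t => z (codeWord k m n t)) ⁻¹' A = ⋃ ω ∈ z ⁻¹' A, {t | codeWord k m n t = ω} := by
      ext t
      simp
    rw [this]
    exact MeasurableSet.biUnion (to_countable _) fun ω _ => measurableSet_codeWord_eq n ω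
  have hae : AEMeasurable φ (volume.restrict (codeInterval m [])) := by
    refine aemeasurable_of_tendsto_metrizable_ae atTop (fun n => (hmeas n).aemeasurable) ?_
    refine (ae_restrict_mem (measurableSet_codeInterval m _)).mono fun t ht => ?_
    refine tendsto_iff_dist_tendsto_zero.2 (squeeze_zero (fun _ => dist_nonneg) (fun n => ?_)
      (g := fun n => lam ^ n * Metric.diam (P [])) ?_)
    · have hmem := hT.codeWord_mem ht
      refine (Metric.dist_le_diam_of_mem (h.isBounded _ (hmem n).1) (hz _ (hmem n).1)
        (hφ t ht n)).trans ?_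
      rw [← initialSegment_nextLetter]
      refine diam_initialSegment_le hlam0.le (fun n => ?_) n
      rw [initialSegment_succ, initialSegment_nextLetter]
      exact (hgeo _ _ (hmem n).1 (hmem (n + 1)).1).2.2
    · simpa using (tendsto_pow_atTop_nhds_zero_of_lt_one hlam0.le hlam1).mul_const _
  have hvol : ∀ ω, volume (codeInterval m ω) = ENNReal.ofReal (m ω) := fun ω => by
    simp [codeInterval]
  have hfinite : IsFiniteMeasure (volume.restrict (codeInterval m [])) :=
    ⟨by rw [Measure.restrict_apply_univ, hvol]; exact ENNReal.ofReal_lt_top⟩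
  refine ⟨(volume.restrict (codeInterval m [])).map φ, inferInstance, ?_, ?_, fun ω hω => ?_⟩
  · rw [Measure.map_apply_of_aemeasurable hae
      (h.isClosed_partitionLimitSet hT.finite_level).measurableSet.compl]
    refine measure_mono_null (t := (codeInterval m [])ᶜ) (fun t ht htm => ht ?_) ?_
    · refine ⟨fun i => nextLetter k m (codeWord k m i t) t, fun n => ?_⟩
      rw [initialSegment_nextLetter]
      exact ⟨(hT.codeWord_mem htm n).1, hφ t htm n⟩
    · rw [Measure.restrict_apply (measurableSet_codeInterval m _).compl, compl_inter_self, measure_empty]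
  · rw [Measure.map_apply_of_aemeasurable hae MeasurableSet.univ, preimage_univ,
      Measure.restrict_apply_univ, hvol]
  · rw [Measure.map_apply_of_aemeasurable hae (h.isClosed ω hω).measurableSet,
      Measure.restrict_apply₀', ← hvol]
    -- For `t` in the coding interval, `φ t` lies in `P ω` exactly when `t` lies in the interval of
    -- `ω`: equal-length pieces are disjoint, so the piece containing `φ t` determines the code
    -- word.
    · congr 1
      ext t
      constructor
      · rintro ⟨h₁, h₂⟩
        obtain ⟨h₃, h₄⟩ := hT.codeWord_mem h₂ ω.length
        have hlen : (codeWord k m ω.length t).length = ω.length := by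
          rw [← initialSegment_nextLetter, length_initialSegment]
        rwa [h.eq_of_mem h₃ hω hlen (hφ t h₂ _) h₁] at h₄
      · intro ht
        have h₂ := hT.codeInterval_subset_nil hω ht
        have := hφ t h₂ ω.length
        rw [hT.codeWord_eq hω ht] at this
        exact ⟨this, h₂⟩
    · exact (measurableSet_codeInterval m _).nullMeasurableSet

end IsPartitionStructure

end Partition

/-! ### Ahlfors regularity of limit sets of partition structures -/

section Regular

variable {Z : Type*} [MetricSpace Z] [MeasurableSpace Z]
  {T : Set (List ℕ)} {P : List ℕ → Set Z}

/-- Along a branch the diameters tend to zero and shrink by a factor of at least `κ` at each step,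
so every small radius is comparable to the diameter of some piece. A ball contains the first piece
of diameter at most `r`, and the gap condition puts it inside a piece of comparable diameter. -/
theorem IsPartitionStructure.isAhlforsRegularSet [BorelSpace Z] (h : IsPartitionStructure T P)
    {k : List ℕ → ℕ} {m : List ℕ → ℝ} (hT : IsWeightedTree T k m)
    (hne : ∀ ω : ℕ → ℕ, (∀ n, initialSegment ω n ∈ T) → ∃ z, ∀ n, z ∈ P (initialSegment ω n))
    {s c : ℝ} (hs : 0 < s) (hc : 0 < c) (hle : ∀ ω ∈ T, c⁻¹ * Metric.diam (P ω) ^ s ≤ m ω)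
    (hge : ∀ ω ∈ T, m ω ≤ c * Metric.diam (P ω) ^ s) :
    IsAhlforsRegularSet s (partitionLimitSet T P) := by
  obtain ⟨μ, hfin, hnull, huniv, hμ⟩ := h.exists_measure hT hne
  obtain ⟨κ, lam, hκ, hlam0, hlam1, hgeo⟩ := h.geometry
  have hm0 := hT.m_pos [] hT.nil_mem
  -- In each constant one summand serves the case where the root already has the right scale, the
  -- other the case where a previous generation exists.
  set C₁ := (m [])⁻¹ + c * (κ⁻¹) ^ s
  set C₂ := c * (κ⁻¹) ^ s + c * ((κ ^ 2)⁻¹) ^ s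
  have hC₁ : 0 < C₁ := by positivity
  have hC₂ : 0 < C₂ := by positivity
  have key : ∀ z ∈ partitionLimitSet T P, ∀ r : ℝ, 0 < r → r < 1 →
      ENNReal.ofReal (C₁⁻¹ * r ^ s) ≤ μ (Metric.closedBall z r) ∧
        μ (Metric.closedBall z r) ≤ ENNReal.ofReal (C₂ * r ^ s) := by
    rintro z ⟨ω, hω⟩ r hr0 hr1
    set D : ℕ → ℝ := fun n => Metric.diam (P (initialSegment ω n)) with hD
    have hD0 : ∀ n, 0 < D n := fun n => h.diam_pos _ (hω n).1
    have hstep : ∀ n, κ * D n ≤ D (n + 1) ∧ D (n + 1) ≤ lam * D n := fun n => by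
      have hmem := (hω (n + 1)).1
      simp only [hD]
      rw [initialSegment_succ] at hmem ⊢
      exact (hgeo _ _ (hω n).1 hmem).2
    have hlim : Tendsto D atTop (𝓝 0) := by
      refine squeeze_zero (fun n => (hD0 n).le)
        (IsPartitionStructure.diam_initialSegment_le hlam0.le fun n => (hstep n).2) ?_
      simpa using (tendsto_pow_atTop_nhds_zero_of_lt_one hlam0.le hlam1).mul_const
        (Metric.diam (P []))
    have hrs : 0 < r ^ s := Real.rpow_pos_of_pos hr0 s
    constructor
    · have hex : ∃ n, D n ≤ r := ((hlim.eventually_lt_const hr0).exists).imp fun _ hn => hn.le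
      have hsub : P (initialSegment ω (Nat.find hex)) ⊆ Metric.closedBall z r := fun y hy =>
        (Metric.dist_le_diam_of_mem (h.isBounded _ (hω _).1) hy (hω _).2).trans (Nat.find_spec hex)
      refine le_trans ?_ (measure_mono hsub)
      rw [hμ _ (hω _).1]
      refine ENNReal.ofReal_le_ofReal ?_
      rcases Nat.eq_zero_or_eq_succ_pred (Nat.find hex) with h0 | hsucc
      · rw [h0, initialSegment_zero]
        have h₁ : C₁⁻¹ ≤ m [] := by
          rw [inv_le_comm₀ hC₁ hm0]
          exact le_add_of_nonneg_right (by positivity)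
        have h₂ : r ^ s ≤ 1 := Real.rpow_le_one hr0.le hr1.le hs.le
        calc C₁⁻¹ * r ^ s ≤ m [] * 1 := mul_le_mul h₁ h₂ hrs.le hm0.le
          _ = m [] := mul_one _
      · have hlt : r < D (Nat.find hex).pred :=
          not_le.1 (Nat.find_min hex (by rw [hsucc]; exact Nat.lt_succ_self _))
        have hκr : κ * r ≤ D (Nat.find hex) := by
          rw [hsucc]
          exact (mul_le_mul_of_nonneg_left hlt.le hκ.le).trans (hstep _).1
        have h₁ : C₁⁻¹ ≤ c⁻¹ * κ ^ s := by
          rw [inv_le_comm₀ hC₁ (by positivity), mul_inv, inv_inv, ← Real.inv_rpow hκ.le]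
          exact le_add_of_nonneg_left (by positivity)
        refine le_trans ?_ (hle _ (hω _).1)
        calc C₁⁻¹ * r ^ s ≤ c⁻¹ * κ ^ s * r ^ s := mul_le_mul_of_nonneg_right h₁ hrs.le
          _ = c⁻¹ * (κ * r) ^ s := by rw [Real.mul_rpow hκ.le hr0.le, mul_assoc]
          _ ≤ c⁻¹ * D (Nat.find hex) ^ s := by gcongr
    · have hex : ∃ n, κ * D n ≤ r := by
        have := hlim.const_mul κ
        rw [mul_zero] at this
        exact ((this.eventually_lt_const hr0).exists).imp fun _ hn => hn.le
      have hspec := Nat.find_spec hex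
      rcases Nat.eq_zero_or_eq_succ_pred (Nat.find hex) with h0 | hsucc
      · rw [h0] at hspec
        refine (measure_mono (subset_univ _)).trans ?_
        rw [huniv]
        refine ENNReal.ofReal_le_ofReal ((hge [] hT.nil_mem).trans ?_)
        have h₁ : Metric.diam (P []) ≤ κ⁻¹ * r := by
          rw [inv_mul_eq_div, le_div_iff₀ hκ, mul_comm]
          exact hspec
        calc c * Metric.diam (P []) ^ s ≤ c * (κ⁻¹ * r) ^ s := by gcongr
          _ = c * κ⁻¹ ^ s * r ^ s := by rw [Real.mul_rpow (by positivity) hr0.le, mul_assoc]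
          _ ≤ C₂ * r ^ s :=
            mul_le_mul_of_nonneg_right (le_add_of_nonneg_right (by positivity)) hrs.le
      · set n := (Nat.find hex).pred
        have hlt : r < κ * D n :=
          not_le.1 (Nat.find_min hex (by rw [hsucc]; exact Nat.lt_succ_self _))
        rw [hsucc] at hspec
        have hmem := hω (n + 1)
        rw [initialSegment_succ] at hmem
        have hsub : Metric.closedBall z r ⊆ P (initialSegment ω n) := fun y hy => by
          by_contra hyn
          have := (hgeo _ _ (hω n).1 hmem.1).1 z hmem.2 y hyn
          exact absurd (this.trans (Metric.mem_closedBall'.1 hy)) (not_le.2 hlt)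
        refine (measure_mono hsub).trans ?_
        rw [hμ _ (hω n).1]
        refine ENNReal.ofReal_le_ofReal ((hge _ (hω n).1).trans ?_)
        have h₁ : D n ≤ (κ ^ 2)⁻¹ * r := by
          rw [inv_mul_eq_div, le_div_iff₀ (by positivity)]
          calc D n * κ ^ 2 = κ * (κ * D n) := by ring
            _ ≤ κ * D (n + 1) := mul_le_mul_of_nonneg_left (hstep n).1 hκ.le
            _ ≤ r := hspec
        calc c * D n ^ s ≤ c * ((κ ^ 2)⁻¹ * r) ^ s := by
              have := hD0 n
              gcongr
          _ = c * (κ ^ 2)⁻¹ ^ s * r ^ s := by rw [Real.mul_rpow (by positivity) hr0.le, mul_assoc]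
          _ ≤ C₂ * r ^ s :=
            mul_le_mul_of_nonneg_right (le_add_of_nonneg_left (by positivity)) hrs.le
  have hsupp : μ.support = partitionLimitSet T P := by
    refine Subset.antisymm (fun z hz => ?_) fun z hz => ?_
    · by_contra hn
      exact Measure.notMem_support_iff_exists.2
        ⟨_, (h.isClosed_partitionLimitSet hT.finite_level).isOpen_compl.mem_nhds hn, hnull⟩ hz
    · refine (Measure.mem_support_iff_forall z).2 fun U hU => ?_
      obtain ⟨ε, hε, hεU⟩ := Metric.nhds_basis_closedBall.mem_iff.1 hU
      have hr0 : 0 < min ε (1 / 2) := by positivity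
      refine lt_of_lt_of_le ?_ (measure_mono
        ((Metric.closedBall_subset_closedBall (min_le_left ε (1 / 2))).trans hεU))
      refine lt_of_lt_of_le ?_ (key z hz _ hr0 ((min_le_right _ _).trans_lt (by norm_num))).1
      exact ENNReal.ofReal_pos.2 (mul_pos (inv_pos.2 hC₁) (Real.rpow_pos_of_pos hr0 s))
  refine ⟨?_, μ, hfin, hsupp, hnull, C₁ + C₂, by positivity, fun z hz r hr0 hr1 => ?_⟩
  · by_contra hn
    rw [not_nonempty_iff_eq_empty.1 hn, compl_empty, huniv] at hnull
    exact absurd (ENNReal.ofReal_eq_zero.1 hnull) (not_le.2 hm0)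
  · rw [hsupp] at hz
    have hrs : 0 < r ^ s := Real.rpow_pos_of_pos hr0 s
    refine ⟨(ENNReal.ofReal_le_ofReal (mul_le_mul_of_nonneg_right ?_ hrs.le)).trans
      (key z hz r hr0 hr1).1, (key z hz r hr0 hr1).2.trans
      (ENNReal.ofReal_le_ofReal (mul_le_mul_of_nonneg_right ?_ hrs.le))⟩
    · exact inv_anti₀ hC₁ (by linarith)
    · linarith

/-- Ahlfors `s`-regular sets have Hausdorff dimension at least `s`. -/
theorem IsAhlforsRegularSet.le_dimH [BorelSpace Z] {s : ℝ≥0} (hs : 0 < s) {J : Set Z}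
    (hJ : IsAhlforsRegularSet s J) : (s : ℝ≥0∞) ≤ dimH J := by
  obtain ⟨⟨z₀, hz₀⟩, μ, hfin, hsupp, hnull, C, hC, hreg⟩ := hJ
  have hs' : (0 : ℝ) < s := hs
  rw [hsupp] at hreg
  have hball : ∀ A : Set Z, ∀ z ∈ A, z ∈ J → Metric.ediam A ≤ ENNReal.ofReal (1 / 2) →
      μ A ≤ ENNReal.ofReal C * Metric.ediam A ^ (s : ℝ) := by
    intro A z hzA hzJ hA
    have hne : Metric.ediam A ≠ ∞ := ne_top_of_le_ne_top ENNReal.ofReal_ne_top hA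
    have hdiam : (Metric.ediam A).toReal ≤ 1 / 2 := ENNReal.toReal_le_of_le_ofReal (by norm_num) hA
    -- Regularity needs a positive radius, whereas `A` may have diameter zero. So the radius is
    -- enlarged by `ε`, which then tends to zero; the bound `1 / 2` keeps it below `1`.
    have hlim : Tendsto (fun ε : ℝ => ENNReal.ofReal C *
        (Metric.ediam A + ENNReal.ofReal ε) ^ (s : ℝ)) (𝓝[>] 0)
        (𝓝 (ENNReal.ofReal C * (Metric.ediam A + ENNReal.ofReal 0) ^ (s : ℝ))) := by
      refine ENNReal.Tendsto.const_mul (((ENNReal.continuous_rpow_const.tendsto _).comp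
        (tendsto_const_nhds.add ((ENNReal.continuous_ofReal.tendsto 0).mono_left
          nhdsWithin_le_nhds)))) (Or.inr ENNReal.ofReal_ne_top)
    rw [ENNReal.ofReal_zero, add_zero] at hlim
    refine ge_of_tendsto hlim ?_
    filter_upwards [Ioo_mem_nhdsGT (show (0 : ℝ) < 1 / 2 by norm_num)] with ε hε
    have hsub : A ⊆ Metric.closedBall z ((Metric.ediam A).toReal + ε) := fun y hy => by
      have := Metric.edist_le_ediam_of_mem hy hzA
      rw [edist_dist, ENNReal.ofReal_le_iff_le_toReal hne] at this
      rw [Metric.mem_closedBall]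
      linarith [hε.1]
    have hpos : 0 < (Metric.ediam A).toReal + ε := add_pos_of_nonneg_of_pos
      ENNReal.toReal_nonneg hε.1
    refine (measure_mono hsub).trans ((hreg z hzJ _ hpos (by linarith [hε.2])).2.trans_eq ?_)
    rw [ENNReal.ofReal_mul hC.le, ← ENNReal.ofReal_rpow_of_pos hpos,
      ENNReal.ofReal_add ENNReal.toReal_nonneg hε.1.le, ENNReal.ofReal_toReal hne]
  have hC0 : ENNReal.ofReal C ≠ 0 := (ENNReal.ofReal_pos.2 hC).ne'
  have hle : (ENNReal.ofReal C)⁻¹ • μ ≤ μH[(s : ℝ)] := by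
    refine Measure.le_hausdorffMeasure _ _ (ENNReal.ofReal (1 / 2))
      (ENNReal.ofReal_pos.2 (by norm_num)) fun A hA => ?_
    rw [Measure.smul_apply, smul_eq_mul]
    by_cases hAJ : (A ∩ J).Nonempty
    · obtain ⟨z, hzA, hzJ⟩ := hAJ
      calc (ENNReal.ofReal C)⁻¹ * μ A
          ≤ (ENNReal.ofReal C)⁻¹ * (ENNReal.ofReal C * Metric.ediam A ^ (s : ℝ)) := by
            gcongr
            exact hball A z hzA hzJ hA
        _ = Metric.ediam A ^ (s : ℝ) := by
            rw [← mul_assoc, ENNReal.inv_mul_cancel hC0 ENNReal.ofReal_ne_top, one_mul]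
    · have : μ A = 0 := measure_mono_null (fun x hx hxJ => hAJ ⟨x, hx, hxJ⟩) hnull
      rw [this, mul_zero]
      exact zero_le
  refine le_dimH_of_hausdorffMeasure_ne_zero fun hzero => ?_
  have hμJ : μ J = 0 := by
    have := hle J
    rw [hzero, Measure.smul_apply, smul_eq_mul, nonpos_iff_eq_zero, mul_eq_zero] at this
    exact this.resolve_left (ENNReal.inv_ne_zero.2 ENNReal.ofReal_ne_top)
  have hμ : μ univ = 0 := by
    rw [← union_compl_self J]
    exact measure_union_null hμJ hnull
  have := (hreg z₀ hz₀ (1 / 2) (by norm_num) (by norm_num)).1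
  rw [measure_mono_null (subset_univ _) hμ, nonpos_iff_eq_zero, ENNReal.ofReal_eq_zero] at this
  exact absurd this (not_le.2 (by positivity))

end Regular

/-! ### The upper bound for the dimension of the radial limit set -/

section UpperBound

variable {X : Type*} [MetricSpace X] {b : ℝ} {o : X} {G : Subgroup (X ≃ᵢ X)}

theorem IsStronglyDiscrete.countable (hG : IsStronglyDiscrete G o) : Countable G := by
  have : (G : Set (X ≃ᵢ X)) = ⋃ n : ℕ, {g : X ≃ᵢ X | g ∈ G ∧ dist o (g o) ≤ n + 1} := by
    ext g
    simp only [mem_iUnion, mem_ofPred_eq, SetLike.mem_coe]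
    refine ⟨fun hg => ?_, fun ⟨_, h⟩ => h.1⟩
    obtain ⟨n, hn⟩ := exists_nat_ge (dist o (g o))
    exact ⟨n, hg, by linarith⟩
  have hc : (G : Set (X ≃ᵢ X)).Countable := by
    rw [this]
    exact countable_iUnion fun n => (hG (n + 1) (by positivity)).countable
  exact hc.to_subtype

variable [HyperbolicSpace X]

theorem ConvergesTo.exists_lt_dist {x : ℕ → X} {η : GromovBoundary X} (h : ConvergesTo o x η)
    (r : ℝ) : ∃ n, r < dist o (x n) := by
  obtain ⟨n, hn⟩ := (h.eventually (lt_mem_nhds (EReal.coe_lt_top r))).exists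
  refine ⟨n, ?_⟩
  obtain ⟨w, hw⟩ := exists_represents η
  obtain ⟨i, hi⟩ := (eventually_of_lt_pointBoundaryProduct hw hn).exists
  rw [dist_comm]
  exact hi.trans_le (gromovProduct_le_dist_right _ _ _)

theorem dimH_radialLimitSet_le [MetricSpace (GromovBoundary X)] (hb : 1 < b)
    (hD : IsVisualMetric X b o) (hG : IsStronglyDiscrete G o) :
    dimH (radialLimitSet G o) ≤ poincareExponent G b o := by
  borelize (GromovBoundary X)
  obtain ⟨C, hC⟩ := exists_isHypConst X
  obtain ⟨c, hc⟩ := hD.exists_isVisualConst hb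
  have hb0 : 0 < b := by linarith
  have hcount := hG.countable
  refine le_iInf₂ fun s hs => ?_
  -- Restricting to natural `σ` makes the union countable, and dimension is countably stable.
  have hcover : radialLimitSet G o ⊆ ⋃ σ : ℕ, {η | ∀ r : ℝ, ∃ g : G, r < dist o ((g : X ≃ᵢ X) o) ∧
      η ∈ shadow o ((g : X ≃ᵢ X) o) σ} := by
    rintro η ⟨g, hg, σ, hσ, hconv, hsh⟩
    obtain ⟨N, hN⟩ := exists_nat_ge σ
    refine mem_iUnion.2 ⟨N, fun r => ?_⟩
    obtain ⟨n, hn⟩ := hconv.exists_lt_dist r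
    exact ⟨⟨g n, hg n⟩, hn, shadow_mono hN (hsh n)⟩
  refine (dimH_mono hcover).trans ?_
  rw [dimH_iUnion]
  refine iSup_le fun σ => dimH_le_of_hausdorffMeasure_ne_top (ne_of_lt ?_)
  set A := c * b ^ ((σ : ℝ) + 1 + 2 * C)
  have hA : 0 ≤ A := mul_nonneg hc.1.le (by positivity)
  have hdiam : ∀ y : X, Metric.ediam (shadow o y (σ : ℝ)) ≤ ENNReal.ofReal (A * b ^ (-dist o y)) :=
    fun y => Metric.ediam_le fun ξ hξ η hη => by
      rw [edist_dist]
      exact ENNReal.ofReal_le_ofReal (dist_le_of_mem_shadow hC hb hc hξ hη)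
  refine (Measure.hausdorffMeasure_le_liminf_tsum (β := ℕ)
    (ι := fun n => {g : G // (n : ℝ) < dist o ((g : X ≃ᵢ X) o)}) (l := atTop) _ _
    (fun n => ENNReal.ofReal (A * b ^ (-(n : ℝ)))) ?_
    (fun n g => shadow o ((g.1 : X ≃ᵢ X) o) (σ : ℝ)) (Eventually.of_forall fun n g => ?_)
    (Eventually.of_forall fun n η hη => ?_)).trans_lt ?_
  · have h₁ : Tendsto (fun n : ℕ => A * (b⁻¹) ^ n) atTop (𝓝 (A * 0)) :=
      (tendsto_pow_atTop_nhds_zero_of_lt_one (by positivity) (inv_lt_one_of_one_lt₀ hb)).const_mul A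
    have h₂ := (ENNReal.continuous_ofReal.tendsto _).comp h₁
    rw [mul_zero, ENNReal.ofReal_zero] at h₂
    refine h₂.congr fun n => ?_
    simp [Real.rpow_neg hb0.le]
  · refine (hdiam _).trans (ENNReal.ofReal_le_ofReal (mul_le_mul_of_nonneg_left ?_ hA))
    exact Real.rpow_le_rpow_of_exponent_le hb.le (neg_le_neg g.2.le)
  · obtain ⟨g, hg, hη⟩ := hη n
    exact mem_iUnion.2 ⟨⟨g, hg⟩, hη⟩
  · refine lt_of_le_of_lt (b := ENNReal.ofReal A ^ (s : ℝ) * poincareSeries G b o s) ?_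
      (ENNReal.mul_lt_top (ENNReal.rpow_lt_top_of_nonneg s.coe_nonneg ENNReal.ofReal_ne_top) hs)
    refine liminf_le_of_frequently_le' (Frequently.of_forall fun n => ?_)
    rw [poincareSeries, ← ENNReal.tsum_mul_left]
    refine le_trans (ENNReal.tsum_le_tsum fun g => ?_)
      (ENNReal.tsum_comp_le_tsum_of_injective Subtype.val_injective _)
    refine (ENNReal.rpow_le_rpow (hdiam _) s.coe_nonneg).trans_eq ?_
    rw [ENNReal.ofReal_mul hA, ENNReal.mul_rpow_of_nonneg _ _ s.coe_nonneg,
      ENNReal.ofReal_rpow_of_pos (Real.rpow_pos_of_pos hb0 _), ← Real.rpow_mul hb0.le]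
    congr 3
    ring

end UpperBound

/-! ### Trees of orbit points with prescribed growth -/

section TreeConstruction

/-- With nestedness, this reduces disjointness of incomparable pieces to that of siblings. -/
theorem exists_first_difference : ∀ ω τ : List ℕ, ¬ ω <+: τ → ¬ τ <+: ω →
    ∃ ρ a a', a ≠ a' ∧ ρ ++ [a] <+: ω ∧ ρ ++ [a'] <+: τ
  | [], _, h, _ => (h (by simp)).elim
  | _ :: _, [], _, h => (h (by simp)).elim
  | b :: ω, b' :: τ, h₁, h₂ => by
    by_cases hb : b = b'
    · subst hb
      simp only [List.cons_prefix_cons, true_and] at h₁ h₂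
      obtain ⟨ρ, a, a', hne, hω, hτ⟩ := exists_first_difference ω τ h₁ h₂
      exact ⟨b :: ρ, a, a', hne, by simpa using hω, by simpa using hτ⟩
    · exact ⟨[], b, b', hb, by simp, by simp⟩

/-- The recursion defining the vertices of the tree and their masses. -/
theorem exists_recursive_labelling {α : Type*} (x₀ : α) (step : α → ℕ → α) (k : α → ℕ) :
    ∃ (x : List ℕ → α) (T : Set (List ℕ)), x [] = x₀ ∧ [] ∈ T ∧
      (∀ ω a, x (ω ++ [a]) = step (x ω) a) ∧ ∀ ω a, ω ++ [a] ∈ T ↔ ω ∈ T ∧ a < k (x ω) := by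
  refine ⟨fun ω => ω.foldl step x₀,
    {ω | ∀ τ a, τ ++ [a] <+: ω → a < k (τ.foldl step x₀)}, rfl, ?_, ?_, ?_⟩
  · intro τ a h
    simp at h
  · intro ω a
    simp
  · intro ω a
    constructor
    · exact fun h => ⟨fun τ a' hτ => h τ a' (hτ.trans (List.prefix_append _ _)),
        h ω a List.prefix_rfl⟩
    · rintro ⟨h₁, h₂⟩ τ a' hτ
      rcases List.prefix_concat_iff.1 hτ with heq | hpre
      · obtain ⟨rfl, h⟩ := List.append_inj' heq rfl
        simpa using (List.cons.inj h).1 ▸ h₂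
      · exact h₁ τ a' hpre

variable {X : Type*} [MetricSpace X] {b s p q B : ℝ} {o : X}

/-- If every point of `Y` has at least `B * b ^ (s * p)` children in `Y`, which are further away
from `o` by an amount between `p` and `q`, then a suitable tree of points of `Y` carries a mass
distribution such that the mass of a point at distance `t` from `o` is comparable to
`b ^ (-s * t)`. -/
theorem exists_weightedTree (hb : 1 < b) (hs : 0 ≤ s) (hp : 0 ≤ p) (hpq : p ≤ q)
    (hB : B = 2 * b ^ (s * (q - p))) {N : ℕ} (hN : B * b ^ (s * p) ≤ N) {Y : Set X} (ho : o ∈ Y)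
    {child : X → ℕ → X} (hY : ∀ x ∈ Y, ∀ a < N, child x a ∈ Y)
    (hchild : ∀ x ∈ Y, ∀ a < N, dist o x + p ≤ dist o (child x a) ∧
      dist o (child x a) ≤ dist o x + q) :
    ∃ (T : Set (List ℕ)) (k : List ℕ → ℕ) (m : List ℕ → ℝ) (x : List ℕ → X),
      IsWeightedTree T k m ∧ x [] = o ∧ ∀ ω ∈ T, x ω ∈ Y ∧ k ω ≤ N ∧
        (∀ a, x (ω ++ [a]) = child (x ω) a) ∧
        b ^ (-(s * dist o (x ω))) ≤ m ω ∧ m ω ≤ B * b ^ (-(s * dist o (x ω))) := by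
  have hb0 : 0 < b := by linarith
  -- With this number of children each receives mass between `b ^ (-s * (d + p))` and twice that,
  -- where `d` is the distance of the parent from `o`. Since a child lies at distance between `d +
  -- p` and `d + q`, the bounds with constants `1` and `B` are restored at every generation instead
  -- of accumulating errors.
  let κ : X × ℝ → ℕ := fun v => ⌊v.2 * b ^ (s * (dist o v.1 + p))⌋₊
  obtain ⟨x, T, hx0, hT0, hx, hT⟩ := exists_recursive_labelling (o, (1 : ℝ))
    (fun v a => (child v.1 a, v.2 / κ v)) κ
  have hB1 : 1 ≤ B := by
    have : 1 ≤ b ^ (s * (q - p)) :=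
      Real.one_le_rpow hb.le (mul_nonneg hs (by linarith))
    linarith
  have hk : ∀ v : X × ℝ, b ^ (-(s * dist o v.1)) ≤ v.2 → v.2 ≤ B * b ^ (-(s * dist o v.1)) →
      0 < κ v ∧ κ v ≤ N ∧ (κ v : ℝ) ≤ v.2 * b ^ (s * (dist o v.1 + p)) ∧
        v.2 * b ^ (s * (dist o v.1 + p)) ≤ 2 * κ v := by
    intro v h₁ h₂
    have hpow : b ^ (-(s * dist o v.1)) * b ^ (s * (dist o v.1 + p)) = b ^ (s * p) := by
      rw [← Real.rpow_add hb0]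
      ring_nf
    have h₃ : 1 ≤ v.2 * b ^ (s * (dist o v.1 + p)) := by
      refine (Real.one_le_rpow hb.le (mul_nonneg hs hp)).trans ?_
      rw [← hpow]
      exact mul_le_mul_of_nonneg_right h₁ (by positivity)
    have h₄ : v.2 * b ^ (s * (dist o v.1 + p)) ≤ B * b ^ (s * p) := by
      rw [← hpow, ← mul_assoc]
      exact mul_le_mul_of_nonneg_right h₂ (by positivity)
    have h₅ : 0 < κ v := Nat.floor_pos.2 h₃
    have h₆ : (κ v : ℝ) ≤ v.2 * b ^ (s * (dist o v.1 + p)) := Nat.floor_le (by linarith)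
    have h₇ : v.2 * b ^ (s * (dist o v.1 + p)) < κ v + 1 := Nat.lt_floor_add_one _
    have h₈ : (1 : ℝ) ≤ κ v := by exact_mod_cast h₅
    refine ⟨h₅, ?_, h₆, by linarith⟩
    exact_mod_cast h₆.trans (h₄.trans hN)
  have hinv : ∀ ω ∈ T, (x ω).1 ∈ Y ∧ b ^ (-(s * dist o (x ω).1)) ≤ (x ω).2 ∧
      (x ω).2 ≤ B * b ^ (-(s * dist o (x ω).1)) := by
    intro ω hω
    induction ω using List.reverseRecOn with
    | nil => simpa [hx0] using ⟨ho, hB1⟩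
    | append_singleton ω a ih =>
      obtain ⟨hωT, ha⟩ := (hT ω a).1 hω
      obtain ⟨h₁, h₂, h₃⟩ := ih hωT
      obtain ⟨k₁, k₂, k₃, k₄⟩ := hk _ h₂ h₃
      obtain ⟨d₁, d₂⟩ := hchild _ h₁ a (ha.trans_le k₂)
      have k₁' : (0 : ℝ) < κ (x ω) := by exact_mod_cast k₁
      rw [hx]
      refine ⟨hY _ h₁ a (ha.trans_le k₂), ?_, ?_⟩
      · show b ^ (-(s * dist o (child (x ω).1 a))) ≤ (x ω).2 / κ (x ω)
        rw [le_div_iff₀ k₁']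
        calc b ^ (-(s * dist o (child (x ω).1 a))) * κ (x ω)
            ≤ b ^ (-(s * (dist o (x ω).1 + p))) * ((x ω).2 * b ^ (s * (dist o (x ω).1 + p))) := by
              refine mul_le_mul (Real.rpow_le_rpow_of_exponent_le hb.le
                (neg_le_neg (mul_le_mul_of_nonneg_left d₁ hs))) k₃ k₁'.le (by positivity)
          _ = (x ω).2 := by
              rw [mul_comm, mul_assoc, ← Real.rpow_add hb0, add_neg_cancel, Real.rpow_zero, mul_one]
      · show (x ω).2 / κ (x ω) ≤ B * b ^ (-(s * dist o (child (x ω).1 a)))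
        rw [div_le_iff₀ k₁']
        calc (x ω).2 = (x ω).2 * b ^ (s * (dist o (x ω).1 + p)) *
              b ^ (-(s * (dist o (x ω).1 + p))) := by
              rw [mul_assoc, ← Real.rpow_add hb0, add_neg_cancel, Real.rpow_zero, mul_one]
          _ ≤ 2 * κ (x ω) * (b ^ (s * (q - p)) * b ^ (-(s * dist o (child (x ω).1 a)))) := by
              rw [← Real.rpow_add hb0]
              refine mul_le_mul k₄ (Real.rpow_le_rpow_of_exponent_le hb.le ?_)
                (by positivity) (by positivity)
              nlinarith [mul_le_mul_of_nonneg_left d₂ hs]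
          _ = B * b ^ (-(s * dist o (child (x ω).1 a))) * κ (x ω) := by rw [hB]; ring
  refine ⟨T, fun ω => κ (x ω), fun ω => (x ω).2, fun ω => (x ω).1,
    ⟨hT0, hT, fun ω hω => (hk _ (hinv ω hω).2.1 (hinv ω hω).2.2).1,
      fun ω hω => lt_of_lt_of_le (by positivity) (hinv ω hω).2.1, fun ω _ a _ => by rw [hx]⟩,
    congrArg Prod.fst hx0, fun ω hω => ⟨(hinv ω hω).1, (hk _ (hinv ω hω).2.1 (hinv ω hω).2.2).2.1,
      fun a => congrArg Prod.fst (hx ω a), (hinv ω hω).2⟩⟩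

end TreeConstruction

/-! ### The shadows of a tree of orbit points -/

section ShadowTree

variable {X : Type*} [MetricSpace X] {C b c K L σ : ℝ} {o : X}

/-- A point behind `y`, as seen from `o`, is also behind `x` if `y` is behind `x` and far away
from `x`. -/
theorem gromovProduct_of_child (hC : IsHypConst X C) {x y u : X} {t : ℝ}
    (hy : gromovProduct o y x ≤ K) (hd : K + t + 2 * C < dist x y)
    (hu : gromovProduct u o y ≤ t) :
    gromovProduct u o x ≤ K + C ∧ dist x y - t - C ≤ gromovProduct u y x := by
  have h₁ := gromovProduct_add_swap x o y
  rw [gromovProduct_comm y o] at h₁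
  have h₂ : gromovProduct u x y ≤ t + C := hC.le_left hu (by linarith [hC.1])
  have h₃ := gromovProduct_add_swap x u y
  rw [gromovProduct_comm x u, gromovProduct_comm y u] at h₃
  have h₄ : gromovProduct o u x ≤ K + C := hC.le_left hy (by linarith)
  rw [gromovProduct_comm] at h₄
  exact ⟨h₄, by linarith⟩

/-- Converts step length into progress away from `o`: a step loses only twice the product at `x`. -/
theorem dist_child (x y : X) :
    dist o y = dist o x + dist x y - 2 * gromovProduct o y x := by
  unfold gromovProduct
  rw [dist_comm y x]
  ring

variable [HyperbolicSpace X]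

/-- The bound `K + C` obtained at the parent does not involve `σ`. This gain is what leaves a
definite gap between the shadow of a child and the complement of the shadow of its parent once `σ ≥
K + 2 * C`. -/
theorem eventually_of_mem_shadow_child (hC : IsHypConst X C) {x y : X}
    (hy : gromovProduct o y x ≤ K) (hd : K + σ + 1 + 3 * C < dist x y) {w : GromovSeq X}
    {η : GromovBoundary X} (hw : Represents w η) (hη : η ∈ shadow o y σ) :
    ∀ᶠ n in atTop, gromovProduct (w.1 n) o x ≤ K + C ∧
      dist x y - σ - 1 - 2 * C ≤ gromovProduct (w.1 n) y x := by
  filter_upwards [eventually_of_mem_shadow hC hw hη] with n hn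
  have := gromovProduct_of_child hC hy (by linarith) hn.le
  exact ⟨this.1, by linarith [this.2]⟩

theorem shadow_child_subset (hC : IsHypConst X C) {x y : X}
    (hy : gromovProduct o y x ≤ K) (hd : K + σ + 1 + 3 * C < dist x y) (hσ : K + C ≤ σ) :
    shadow o y σ ⊆ shadow o x σ := by
  intro η hη
  obtain ⟨w, hw⟩ := exists_represents η
  exact mem_shadow_of_frequently hw ((eventually_of_mem_shadow_child hC hy hd hw hη).mono
    fun n hn => hn.1.trans hσ).frequently

theorem le_dist_of_mem_shadow_child [MetricSpace (GromovBoundary X)] (hC : IsHypConst X C)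
    (hc : IsVisualConst X b o c) {x y : X}
    (hy : gromovProduct o y x ≤ K) (hd : K + σ + 1 + 3 * C < dist x y) (hσ : K + 2 * C ≤ σ)
    {η ζ : GromovBoundary X} (hη : η ∈ shadow o y σ) (hζ : ζ ∉ shadow o x σ) :
    c⁻¹ * b ^ (-(K + 2 * C + dist o x)) ≤ dist η ζ := by
  obtain ⟨w, hw⟩ := exists_represents η
  obtain ⟨v, hv⟩ := exists_represents ζ
  refine (hc.2 η ζ w v hw hv _).1 (Eventually.frequently ?_)
  filter_upwards [eventually_fst (eventually_of_mem_shadow_child hC hy hd hw hη),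
    eventually_snd (eventually_of_notMem_shadow hv hζ)] with q h₁ h₂
  have h₃ := gromovProduct_le_add_dist (w.1 q.1) (v.1 q.2) o x
  have h₄ : gromovProduct (w.1 q.1) (v.1 q.2) x ≤ K + C + C := hC.le_left h₁.1 (by linarith)
  linarith

/-- Seen from `x`, a common point would be close to both `y` and `y'`, which have nearly the same
distance to `x`, so `y` and `y'` would be near each other. In the resulting bound `n` cancels, so
`M` may be fixed before `n`. -/
theorem disjoint_shadow_child (hC : IsHypConst X C) {x y y' : X} {n M : ℝ}
    (hy : gromovProduct o y x ≤ K) (hd : K + σ + 1 + 3 * C < dist x y)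
    (hy' : gromovProduct o y' x ≤ K) (hd' : K + σ + 1 + 3 * C < dist x y')
    (h₁ : n - L ≤ dist x y) (h₂ : dist x y ≤ n + 1 + L) (h₁' : n - L ≤ dist x y')
    (h₂' : dist x y' ≤ n + 1 + L) (hM : 2 * (2 * L + σ + 3 * C + 3) ≤ M)
    (hyy : M ≤ dist y y') : Disjoint (shadow o y σ) (shadow o y' σ) := by
  refine disjoint_left.2 fun η hη hη' => ?_
  obtain ⟨w, hw⟩ := exists_represents η
  obtain ⟨i, h₃, h₄⟩ := ((eventually_of_mem_shadow_child hC hy hd hw hη).and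
    (eventually_of_mem_shadow_child hC hy' hd' hw hη')).exists
  have h₅ := h₃.2
  rw [gromovProduct_comm] at h₅
  have h₆ : n - L - σ - 1 - 3 * C ≤ gromovProduct y y' x :=
    hC.le (y := w.1 i) (by linarith) (by linarith)
  unfold gromovProduct at h₆
  rw [dist_comm y x, dist_comm y' x] at h₆
  linarith

/-- A sequence of orbit points that goes to infinity with bounded steps converges uniformly
radially to each boundary point which is contained in all of its shadows. -/
theorem mem_uniformlyRadialLimitSet {G : Subgroup (X ≃ᵢ X)} (hC : IsHypConst X C) {x : ℕ → X}
    (hx : ∀ n, x n ∈ orbitSet G o) (h0 : x 0 = o) {D : ℝ} (hD : ∀ n, dist (x n) (x (n + 1)) ≤ D)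
    (hn : ∀ n : ℕ, (n : ℝ) ≤ dist o (x n)) {η : GromovBoundary X}
    (hη : ∀ n, η ∈ shadow o (x n) σ) : η ∈ uniformlyRadialLimitSet G o := by
  choose g hg hgx using hx
  obtain rfl : x = fun n => g n o := funext hgx
  refine ⟨g, hg, max (max σ D) 1, by positivity, ⟨?_, fun n => shadow_mono
    ((le_max_left _ _).trans (le_max_left _ _)) (hη n)⟩,
    fun n => (hD n).trans ((le_max_right _ _).trans (le_max_left _ _)), h0⟩
  refine EReal.tendsto_nhds_top_iff_real.2 fun t => ?_
  obtain ⟨N, hN⟩ := exists_nat_gt (t + σ + 1 + 2 * C)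
  filter_upwards [eventually_ge_atTop N] with n hnN
  obtain ⟨w, hw⟩ := exists_represents η
  have hNn : (N : ℝ) ≤ n := by exact_mod_cast hnN
  have hdn := hn n
  refine lt_of_lt_of_le (EReal.coe_lt_coe_iff.2 (by linarith : t < n - σ - 1 - 2 * C))
    (le_pointBoundaryProduct hC hw (Eventually.frequently ?_))
  filter_upwards [eventually_of_mem_shadow hC hw (hη n)] with i hi
  have h₁ := gromovProduct_add_swap (g n o) (w.1 i) o
  rw [gromovProduct_comm (g n o), gromovProduct_comm o, dist_comm] at h₁
  linarith

/-- A sequence in which each point is behind the previous one, as seen from `o`, converges to a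
boundary point in all of its shadows. -/
theorem exists_mem_shadow (hC : IsHypConst X C) (hK : 0 ≤ K) {x : ℕ → X}
    (hx : ∀ n, gromovProduct o (x (n + 1)) (x n) ≤ K)
    (hd : ∀ n, K + (K + C) + 2 * C < dist (x n) (x (n + 1)))
    (hn : ∀ n : ℕ, (n : ℝ) ≤ dist o (x n)) (hσ : K + C ≤ σ) :
    ∃ η : GromovBoundary X, ∀ n, η ∈ shadow o (x n) σ := by
  -- The bound `K + C` reproduces itself when passed from `x (n + 1)` to `x n`, so it holds for all
  -- later points.
  have key : ∀ j n, gromovProduct (x (n + j)) o (x n) ≤ K + C := by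
    intro j
    induction j with
    | zero =>
      intro n
      rw [add_zero, gromovProduct_self_left]
      linarith [hC.1]
    | succ j ih =>
      intro n
      have := ih (n + 1)
      rw [show n + 1 + j = n + (j + 1) by ring] at this
      exact (gromovProduct_of_child hC (hx n) (hd n) this).1
  have key' : ∀ n m : ℕ, n ≤ m → (n : ℝ) - K - C ≤ gromovProduct (x n) (x m) o := by
    intro n m hnm
    obtain ⟨j, rfl⟩ := Nat.exists_eq_add_of_le hnm
    have h₁ := gromovProduct_add_swap (x n) (x (n + j)) o
    rw [gromovProduct_comm o, dist_comm] at h₁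
    linarith [key j n, hn n]
  have hseq : IsGromovSeq x := by
    intro z
    refine tendsto_atTop.2 fun t => ?_
    obtain ⟨N, hN⟩ := exists_nat_gt (t + K + C + dist o z)
    filter_upwards [eventually_ge_atTop (N, N)] with q hq
    have hq1 : (N : ℝ) ≤ q.1 := by exact_mod_cast hq.1
    have hq2 : (N : ℝ) ≤ q.2 := by exact_mod_cast hq.2
    have h₁ := gromovProduct_le_add_dist (x q.1) (x q.2) o z
    rcases le_total q.1 q.2 with h | h
    · linarith [key' _ _ h]
    · have := key' _ _ h
      rw [gromovProduct_comm] at this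
      linarith
  refine ⟨Quotient.mk (gromovSetoid X) ⟨x, hseq⟩, fun n => mem_shadow_of_frequently
    (x := ⟨x, hseq⟩) rfl (Eventually.frequently ?_)⟩
  filter_upwards [eventually_ge_atTop n] with m hm
  obtain ⟨j, rfl⟩ := Nat.exists_eq_add_of_le hm
  exact (key j n).trans hσ

end ShadowTree

/-! ### The partition structure of shadows and the lower bound for the dimension -/

section Main

theorem IsWeightedTree.isTree {T : Set (List ℕ)} {k : List ℕ → ℕ} {m : List ℕ → ℝ}
    (h : IsWeightedTree T k m) : IsTree T := by
  refine ⟨⟨[], h.nil_mem⟩, fun ω τ hpre hτ => ?_⟩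
  induction τ using List.reverseRecOn with
  | nil => rwa [List.prefix_nil.1 hpre]
  | append_singleton τ a ih =>
    rcases List.prefix_concat_iff.1 hpre with rfl | hpre'
    · exact hτ
    · exact ih hpre' (h.mem_of_append_mem hτ)

variable {X : Type*} [MetricSpace X] [HyperbolicSpace X] [MetricSpace (GromovBoundary X)]
  {C b c K L σ : ℝ} {o : X}

/-- The shadows of a tree of points form a partition structure if every vertex is followed by
points which are behind it, far away from it and far away from each other. -/
theorem isPartitionStructure_shadow (hC : IsHypConst X C) (hb : 1 < b)
    (hc : IsVisualConst X b o c) {T : Set (List ℕ)} (hT : IsTree T) {x : List ℕ → X}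
    {n M A₁ A₂ : ℝ} (hσ : K + 2 * C ≤ σ)
    (hd₁ : ∀ ω a, ω ++ [a] ∈ T → n - L ≤ dist (x ω) (x (ω ++ [a])))
    (hd₂ : ∀ ω a, ω ++ [a] ∈ T → dist (x ω) (x (ω ++ [a])) ≤ n + 1 + L)
    (hgp : ∀ ω a, ω ++ [a] ∈ T → gromovProduct o (x (ω ++ [a])) (x ω) ≤ K)
    (hsep : ∀ ω a a', ω ++ [a] ∈ T → ω ++ [a'] ∈ T → a ≠ a' →
      M ≤ dist (x (ω ++ [a])) (x (ω ++ [a'])))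
    (hM : 2 * (2 * L + σ + 3 * C + 3) ≤ M) (hn : K + σ + 1 + 3 * C < n - L)
    (hA₁ : 0 < A₁) (hdiam₁ : ∀ ω ∈ T, A₁ * b ^ (-dist o (x ω)) ≤ Metric.diam (shadow o (x ω) σ))
    (hdiam₂ : ∀ ω ∈ T, Metric.diam (shadow o (x ω) σ) ≤ A₂ * b ^ (-dist o (x ω)))
    (hp : A₂ * b ^ (-(n - L - 2 * K)) ≤ A₁ / 2) :
    IsPartitionStructure T fun ω => shadow o (x ω) σ := by
  have hb0 : 0 < b := by linarith
  have hd : ∀ ω a, ω ++ [a] ∈ T → K + σ + 1 + 3 * C < dist (x ω) (x (ω ++ [a])) :=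
    fun ω a h => hn.trans_le (hd₁ ω a h)
  have hC0 := hC.1
  obtain ⟨τ₀, hτ₀⟩ := hT.1
  have hA₂ : 0 < A₂ := by
    have h₁ := (hdiam₁ τ₀ hτ₀).trans (hdiam₂ τ₀ hτ₀)
    exact hA₁.trans_le (le_of_mul_le_mul_right h₁ (Real.rpow_pos_of_pos hb0 _))
  have hpos : ∀ ω ∈ T, 0 < Metric.diam (shadow o (x ω) σ) := fun ω hω =>
    (mul_pos hA₁ (Real.rpow_pos_of_pos hb0 _)).trans_le (hdiam₁ ω hω)
  have hnested : ∀ τ ∈ T, ∀ ω, ω <+: τ → shadow o (x τ) σ ⊆ shadow o (x ω) σ := by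
    intro τ hτ ω hpre
    induction τ using List.reverseRecOn with
    | nil => rw [List.prefix_nil.1 hpre]
    | append_singleton τ a ih =>
      rcases List.prefix_concat_iff.1 hpre with rfl | hpre'
      · exact Subset.rfl
      · exact (shadow_child_subset hC (hgp τ a hτ) (hd τ a hτ) (by linarith)).trans
          (ih (hT.2 _ _ (List.prefix_append _ _) hτ) hpre')
  refine ⟨hT, fun ω _ => isClosed_shadow hb hc _ _, fun ω _ => isBounded_shadow hC hb hc _ _,
    hpos, fun ω _ τ hτ hpre => hnested τ hτ ω hpre, fun ω hω τ hτ h₁ h₂ => ?_, ?_⟩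
  · obtain ⟨ρ, a, a', hne, hρω, hρτ⟩ := exists_first_difference ω τ h₁ h₂
    have hω' := hT.2 _ _ hρω hω
    have hτ' := hT.2 _ _ hρτ hτ
    exact (disjoint_shadow_child hC (hgp _ _ hω') (hd _ _ hω') (hgp _ _ hτ') (hd _ _ hτ')
      (hd₁ _ _ hω') (hd₂ _ _ hω') (hd₁ _ _ hτ') (hd₂ _ _ hτ') hM (hsep _ _ _ hω' hτ' hne)).mono
      (hnested ω hω _ hρω) (hnested τ hτ _ hρτ)
  -- The constant `κ₁` comes from the gap to the complement of the parent, `κ₂` from the maximal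
  -- step length `n + 1 + L`. The contraction ratio `1 / 2` is what `hp` provides.
  · set κ₁ := c⁻¹ * b ^ (-(K + 2 * C)) / A₂
    set κ₂ := A₁ * b ^ (-(n + 1 + L)) / A₂
    have hκ₁ : 0 < κ₁ := div_pos (mul_pos (inv_pos.2 hc.1) (Real.rpow_pos_of_pos hb0 _)) hA₂
    have hκ₂ : 0 < κ₂ := div_pos (mul_pos hA₁ (Real.rpow_pos_of_pos hb0 _)) hA₂
    have hκ : ∀ ω ∈ T, min κ₁ κ₂ * Metric.diam (shadow o (x ω) σ) ≤
        min κ₁ κ₂ * (A₂ * b ^ (-dist o (x ω))) := fun ω hω =>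
      mul_le_mul_of_nonneg_left (hdiam₂ ω hω) (lt_min hκ₁ hκ₂).le
    refine ⟨min κ₁ κ₂, 1 / 2, lt_min hκ₁ hκ₂, by norm_num, by norm_num, fun ω a hω hωa =>
      ⟨fun η hη ζ hζ => ?_, ?_, ?_⟩⟩
    · refine (hκ ω hω).trans (le_trans ?_
        (le_dist_of_mem_shadow_child hC hc (hgp _ _ hωa) (hd _ _ hωa) hσ hη hζ))
      calc min κ₁ κ₂ * (A₂ * b ^ (-dist o (x ω))) ≤ κ₁ * (A₂ * b ^ (-dist o (x ω))) := by
            gcongr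
            exact min_le_left _ _
        _ = c⁻¹ * b ^ (-(K + 2 * C + dist o (x ω))) := by
            rw [neg_add, Real.rpow_add hb0]
            simp only [κ₁]
            field_simp
    · refine (hκ ω hω).trans (le_trans ?_ (hdiam₁ _ hωa))
      calc min κ₁ κ₂ * (A₂ * b ^ (-dist o (x ω))) ≤ κ₂ * (A₂ * b ^ (-dist o (x ω))) := by
            gcongr
            exact min_le_right _ _
        _ = A₁ * b ^ (-(n + 1 + L) + -dist o (x ω)) := by
            rw [Real.rpow_add hb0]
            simp only [κ₂]
            field_simp
        _ ≤ A₁ * b ^ (-dist o (x (ω ++ [a]))) := by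
            refine mul_le_mul_of_nonneg_left (Real.rpow_le_rpow_of_exponent_le hb.le ?_) hA₁.le
            have := dist_triangle o (x ω) (x (ω ++ [a]))
            linarith [hd₂ _ _ hωa]
    · refine (hdiam₂ _ hωa).trans ?_
      calc A₂ * b ^ (-dist o (x (ω ++ [a])))
          ≤ A₂ * (b ^ (-(n - L - 2 * K)) * b ^ (-dist o (x ω))) := by
            rw [← Real.rpow_add hb0]
            refine mul_le_mul_of_nonneg_left (Real.rpow_le_rpow_of_exponent_le hb.le ?_) hA₂.le
            rw [dist_child (x ω)]
            linarith [hd₁ _ _ hωa, hgp _ _ hωa]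
        _ ≤ A₁ / 2 * b ^ (-dist o (x ω)) := by
            rw [← mul_assoc]
            gcongr
        _ ≤ 1 / 2 * Metric.diam (shadow o (x ω) σ) := by linarith [hdiam₁ ω hω]

/-- Below the Poincaré exponent there are trees of orbit points whose shadows form a partition
structure with an Ahlfors regular limit set of uniformly radial limit points. -/
theorem exists_tree_of_lt_poincareExponent [MeasurableSpace (GromovBoundary X)]
    [BorelSpace (GromovBoundary X)] (hb : 1 < b) (hD : IsVisualMetric X b o)
    {G : Subgroup (X ≃ᵢ X)} (hdisc : IsStronglyDiscrete G o) (hgen : IsGeneralType G)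
    {s : ℝ} (hs : 0 < s) (hsδ : ENNReal.ofReal s < poincareExponent G b o) :
    ∃ σ₀ : ℝ, ∀ σ : ℝ, σ₀ ≤ σ → ∃ (T : Set (List ℕ)) (x : List ℕ → X),
      Set.InjOn x T ∧ (∀ ω ∈ T, ∃ g ∈ G, x ω = g o) ∧
      IsPartitionStructure T (fun ω => shadow o (x ω) σ) ∧
      partitionLimitSet T (fun ω => shadow o (x ω) σ) ⊆ uniformlyRadialLimitSet G o ∧
      IsAhlforsRegularSet s (partitionLimitSet T (fun ω => shadow o (x ω) σ)) := by
  have hb0 : 0 < b := by linarith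
  obtain ⟨C, hC⟩ := exists_isHypConst X
  obtain ⟨c, hc⟩ := hD.exists_isVisualConst hb
  obtain ⟨s', hss', hs'δ⟩ := ENNReal.lt_iff_exists_nnreal_btwn.1 hsδ
  have hss'' : s < s' := by
    rwa [← ENNReal.ofReal_coe_nnreal, ENNReal.ofReal_lt_ofReal_iff_of_nonneg hs.le] at hss'
  have hdiv : poincareSeries G b o s' = ∞ := by
    by_contra hne
    exact (iInf₂_le (f := fun (s : ℝ≥0) (_ : poincareSeries G b o (s : ℝ) < ∞) => (s : ℝ≥0∞))
      s' (lt_top_iff_ne_top.2 hne)).not_gt hs'δ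
  obtain ⟨K₀, hK₀, hfour⟩ := hgen.exists_four hC hb hc hdisc
  obtain ⟨A₁, hA₁, σ₁, hdiam₁⟩ : ∃ a > 0, ∃ σ₁ : ℝ, ∀ σ ≥ σ₁, ∀ g : X ≃ᵢ X,
      a * b ^ (-dist o (g o)) ≤ Metric.diam (shadow o (g o) σ) := by
    obtain ⟨g₁, -, g₂, -, p₁, m₁, p₂, m₂, h₁, -, hdisj⟩ := hgen
    rw [disjoint_left] at hdisj
    exact exists_le_diam_shadow hC hb hc h₁.1
      (fun h => hdisj (a := p₁) (by simp) (by simp [h]) : p₁ ≠ p₂)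
      (fun h => hdisj (a := m₁) (by simp) (by simp [h]) : m₁ ≠ p₂)
  obtain ⟨L, hL, hchildren⟩ := exists_children hC hb hdisc hfour hs.le hss'' hdiv
  have hC0 := hC.1
  set K := K₀ + 3 * C
  have hK : 0 ≤ K := by positivity
  -- Above `σ₁` shadows of orbit points are not too small; above `K + 2 * C` the gap estimate
  -- applies.
  refine ⟨max σ₁ (K + 2 * C), fun σ hσ => ?_⟩
  have hσ₁ : σ₁ ≤ σ := (le_max_left _ _).trans hσ
  have hσ₂ : K + 2 * C ≤ σ := (le_max_right _ _).trans hσ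
  set A₂ := c * b ^ (σ + 1 + 2 * C)
  have hA₂ : 0 < A₂ := mul_pos hc.1 (Real.rpow_pos_of_pos hb0 _)
  -- The exponent contains the spread `q - p` for `p = n - L - 2 * K` and `q = n + 1 + L`. It does
  -- not depend on `n`, so the number of children can be requested in terms of `B` before `n` is
  -- known.
  set B := 2 * b ^ (s * (2 * L + 2 * K + 1))
  have hB : 0 < B := by positivity
  -- The three conditions make steps long enough for the shadow estimates, gain distance at least
  -- `1` from `o` per generation, and halve the diameters.
  obtain ⟨N₀, hN₀⟩ : ∃ N₀ : ℕ, ∀ n ≥ N₀, K + σ + 1 + 3 * C < n - L ∧ 1 ≤ n - L - 2 * K ∧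
      A₂ * b ^ (-((n : ℝ) - L - 2 * K)) ≤ A₁ / 2 := by
    have h₁ : Tendsto (fun n : ℕ => A₂ * b ^ (L + 2 * K) * (b⁻¹) ^ n) atTop (𝓝 0) := by
      simpa using (tendsto_pow_atTop_nhds_zero_of_lt_one (inv_nonneg.2 hb0.le)
        (inv_lt_one_of_one_lt₀ hb)).const_mul (A₂ * b ^ (L + 2 * K))
    have h₂ := h₁.eventually_lt_const (show 0 < A₁ / 2 by positivity)
    have h₃ := tendsto_natCast_atTop_atTop (R := ℝ)
    obtain ⟨N₀, hN₀⟩ := eventually_atTop.1 (h₂.and ((h₃.eventually_gt_atTop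
      (K + σ + 1 + 3 * C + L)).and (h₃.eventually_ge_atTop (1 + L + 2 * K))))
    refine ⟨N₀, fun n hn => ?_⟩
    obtain ⟨i₁, i₂, i₃⟩ := hN₀ n hn
    refine ⟨by linarith, by linarith, i₁.le.trans' (Eq.le ?_)⟩
    rw [show -((n : ℝ) - L - 2 * K) = L + 2 * K + -n by ring, Real.rpow_add hb0,
      Real.rpow_neg hb0.le, Real.rpow_natCast, inv_pow]
    ring
  obtain ⟨n, hn, N, hN, child, hchild⟩ :=
    hchildren (2 * (2 * L + σ + 3 * C + 3)) B N₀
  obtain ⟨n₁, n₂, n₃⟩ := hN₀ n hn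
  obtain ⟨T, k, m, x, hT, hx0, hx⟩ := exists_weightedTree (o := o) (p := n - L - 2 * K)
    (q := n + 1 + L) (B := B) (N := N) (Y := orbitSet G o) hb hs.le (by linarith) (by linarith)
    (by simp only [B]; ring_nf)
    (hN.trans' (mul_le_mul_of_nonneg_left (Real.rpow_le_rpow_of_exponent_le hb.le
      (mul_le_mul_of_nonneg_left (by linarith) hs.le)) hB.le))
    ⟨1, G.one_mem, rfl⟩ (fun x hx a ha => (hchild x hx a ha).1) (fun x hx a ha => by
      obtain ⟨-, i₂, i₃, i₄, -⟩ := hchild x hx a ha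
      have i₅ := gromovProduct_nonneg o (child x a) x
      have i₆ := dist_child (o := o) x (child x a)
      constructor <;> linarith)
  have hedge : ∀ ω a, ω ++ [a] ∈ T → x ω ∈ orbitSet G o ∧ a < N ∧
      x (ω ++ [a]) = child (x ω) a := fun ω a h => by
    obtain ⟨h₁, h₂⟩ := (hT.append_mem_iff ω a).1 h
    obtain ⟨i₁, i₂, i₃, -⟩ := hx ω h₁
    exact ⟨i₁, h₂.trans_le i₂, i₃ a⟩
  have hchild' : ∀ ω a, ω ++ [a] ∈ T → n - L ≤ dist (x ω) (x (ω ++ [a])) ∧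
      dist (x ω) (x (ω ++ [a])) ≤ n + 1 + L ∧ gromovProduct o (x (ω ++ [a])) (x ω) ≤ K := by
    intro ω a h
    obtain ⟨h₁, h₂, h₃⟩ := hedge ω a h
    obtain ⟨-, i₂, i₃, i₄, -⟩ := hchild _ h₁ a h₂
    rw [h₃]
    exact ⟨i₂, i₃, i₄⟩
  have hlow : ∀ ω ∈ T, A₁ * b ^ (-dist o (x ω)) ≤ Metric.diam (shadow o (x ω) σ) := by
    intro ω hω
    obtain ⟨g, -, hg⟩ := (hx ω hω).1
    rw [hg]
    exact hdiam₁ σ hσ₁ g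
  have hup : ∀ ω ∈ T, Metric.diam (shadow o (x ω) σ) ≤ A₂ * b ^ (-dist o (x ω)) :=
    fun ω _ => diam_shadow_le hC hb hc _ _
  have hP : IsPartitionStructure T fun ω => shadow o (x ω) σ :=
    isPartitionStructure_shadow (K := K) (L := L) hC hb hc hT.isTree hσ₂
      (fun ω a h => (hchild' ω a h).1) (fun ω a h => (hchild' ω a h).2.1)
      (fun ω a h => (hchild' ω a h).2.2)
      (fun ω a a' h h' hne => by
        obtain ⟨h₁, h₂, h₃⟩ := hedge ω a h
        obtain ⟨-, h₂', h₃'⟩ := hedge ω a' h'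
        rw [h₃, h₃']
        exact (hchild _ h₁ a h₂).2.2.2.2 a' h₂' hne)
      le_rfl n₁ hA₁ hlow hup n₃
  have hbranch : ∀ ω : ℕ → ℕ, (∀ i, initialSegment ω i ∈ T) →
      ∀ i, initialSegment ω i ++ [ω i] ∈ T := fun ω hω i => by
    rw [← initialSegment_succ]
    exact hω (i + 1)
  have hfar : ∀ ω : ℕ → ℕ, (∀ i, initialSegment ω i ∈ T) →
      ∀ i : ℕ, (i : ℝ) ≤ dist o (x (initialSegment ω i)) := by
    intro ω hω i
    induction i with
    | zero => simp
    | succ i ih =>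
      obtain ⟨i₁, -, i₃⟩ := hchild' _ _ (hbranch ω hω i)
      rw [initialSegment_succ, dist_child (x (initialSegment ω i))]
      push_cast
      linarith
  refine ⟨T, x, fun ω hω τ hτ h => hP.injOn hω hτ (by simp only [h]), fun ω hω => (hx ω hω).1, hP,
    ?_, ?_⟩
  · rintro η ⟨ω, hω⟩
    refine mem_uniformlyRadialLimitSet (x := fun i => x (initialSegment ω i)) (D := n + 1 + L)
      (σ := σ) hC (fun i => (hx _ (hω i).1).1) hx0 (fun i => ?_) (hfar ω fun i => (hω i).1)
      fun i => (hω i).2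
    show dist (x (initialSegment ω i)) (x (initialSegment ω (i + 1))) ≤ _
    rw [initialSegment_succ]
    exact (hchild' _ _ (hbranch ω (fun i => (hω i).1) i)).2.1
  · refine hP.isAhlforsRegularSet hT (fun ω hω => ?_) hs
      (c := B * A₁⁻¹ ^ s + A₂ ^ s) (by positivity) (fun ω hω => ?_) fun ω hω => ?_
    · refine exists_mem_shadow (x := fun i => x (initialSegment ω i)) (K := K) hC hK (fun i => ?_)
        (fun i => ?_) (hfar ω hω) (by linarith)
      · show gromovProduct o (x (initialSegment ω (i + 1))) (x (initialSegment ω i)) ≤ K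
        rw [initialSegment_succ]
        exact (hchild' _ _ (hbranch ω hω i)).2.2
      · show _ < dist (x (initialSegment ω i)) (x (initialSegment ω (i + 1)))
        rw [initialSegment_succ]
        linarith [(hchild' _ _ (hbranch ω hω i)).1]
    · have hDpos := (hP.diam_pos ω hω).le
      have hpow : b ^ (-(s * dist o (x ω))) = (b ^ (-dist o (x ω))) ^ s := by
        rw [← Real.rpow_mul hb0.le]
        ring_nf
      refine le_trans ?_ (hx ω hω).2.2.2.1
      have h₁ : Metric.diam (shadow o (x ω) σ) ^ s ≤ A₂ ^ s * (b ^ (-dist o (x ω))) ^ s := by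
        rw [← Real.mul_rpow hA₂.le (by positivity)]
        exact Real.rpow_le_rpow hDpos (hup ω hω) hs.le
      rw [hpow, inv_mul_le_iff₀ (by positivity)]
      refine h₁.trans (mul_le_mul_of_nonneg_right ?_ (by positivity))
      exact le_add_of_nonneg_left (by positivity)
    · have hDpos := (hP.diam_pos ω hω).le
      have hpow : b ^ (-(s * dist o (x ω))) = (b ^ (-dist o (x ω))) ^ s := by
        rw [← Real.rpow_mul hb0.le]
        ring_nf
      refine (hx ω hω).2.2.2.2.trans ?_
      have h₁ : (b ^ (-dist o (x ω))) ^ s ≤ A₁⁻¹ ^ s * Metric.diam (shadow o (x ω) σ) ^ s := by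
        rw [← Real.mul_rpow (by positivity) hDpos]
        refine Real.rpow_le_rpow (by positivity) ?_ hs.le
        rw [le_inv_mul_iff₀ hA₁]
        exact hlow ω hω
      rw [hpow]
      calc B * (b ^ (-dist o (x ω))) ^ s
          ≤ B * (A₁⁻¹ ^ s * Metric.diam (shadow o (x ω) σ) ^ s) := by gcongr
        _ = B * A₁⁻¹ ^ s * Metric.diam (shadow o (x ω) σ) ^ s := by ring
        _ ≤ (B * A₁⁻¹ ^ s + A₂ ^ s) * Metric.diam (shadow o (x ω) σ) ^ s := by
          refine mul_le_mul_of_nonneg_right ?_ (by positivity)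
          exact le_add_of_nonneg_right (by positivity)

theorem uniformlyRadialLimitSet_subset {X : Type*} [MetricSpace X] [HyperbolicSpace X]
    (G : Subgroup (X ≃ᵢ X)) (o : X) : uniformlyRadialLimitSet G o ⊆ radialLimitSet G o :=
  fun _ ⟨g, hg, σ, hσ, h, _⟩ => ⟨g, hg, σ, hσ, h⟩

theorem le_dimH_uniformlyRadialLimitSet (hb : 1 < b) (hD : IsVisualMetric X b o)
    {G : Subgroup (X ≃ᵢ X)} (hdisc : IsStronglyDiscrete G o) (hgen : IsGeneralType G) :
    poincareExponent G b o ≤ dimH (uniformlyRadialLimitSet G o) := by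
  borelize (GromovBoundary X)
  refine ENNReal.le_of_forall_nnreal_lt fun s hs => ?_
  -- Regular sets are constructed only for positive exponents; for `0` the bound is trivial.
  rcases eq_or_ne s 0 with rfl | hs0
  · simp
  have hspos : 0 < s := pos_iff_ne_zero.2 hs0
  obtain ⟨σ₀, hσ₀⟩ := exists_tree_of_lt_poincareExponent hb hD hdisc hgen
    (NNReal.coe_pos.2 hspos) (by rwa [ENNReal.ofReal_coe_nnreal])
  obtain ⟨T, x, -, -, -, hsub, hreg⟩ := hσ₀ σ₀ le_rfl
  exact (hreg.le_dimH hspos).trans (dimH_mono hsub)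

end Main

end GromovHyp

open GromovHyp in
theorem mainTheorem1 {X : Type*} [MetricSpace X] [HyperbolicSpace X] (o : X)
    (b : ℝ) (hb : 1 < b)
    [MetricSpace (GromovBoundary X)] [MeasurableSpace (GromovBoundary X)]
    [BorelSpace (GromovBoundary X)] (hD : IsVisualMetric X b o)
    (G : Subgroup (X ≃ᵢ X)) (hdisc : IsStronglyDiscrete G o) (hgen : IsGeneralType G) :
    dimH (radialLimitSet G o) = poincareExponent G b o ∧
    dimH (uniformlyRadialLimitSet G o) = poincareExponent G b o ∧
    ∀ s : ℝ, 0 < s → ENNReal.ofReal s < poincareExponent G b o →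
      ∃ σ₀ : ℝ, ∀ σ : ℝ, σ₀ ≤ σ →
        ∃ (T : Set (List ℕ)) (x : List ℕ → X),
          Set.InjOn x T ∧
          (∀ ω ∈ T, ∃ g ∈ G, x ω = g o) ∧
          IsPartitionStructure T (fun ω => shadow o (x ω) σ) ∧
          partitionLimitSet T (fun ω => shadow o (x ω) σ) ⊆ uniformlyRadialLimitSet G o ∧
          IsAhlforsRegularSet s (partitionLimitSet T (fun ω => shadow o (x ω) σ)) := by
  have hlow := le_dimH_uniformlyRadialLimitSet hb hD hdisc hgen
  have hup := dimH_radialLimitSet_le hb hD hdisc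
  have hmono := dimH_mono (uniformlyRadialLimitSet_subset G o)
  exact ⟨le_antisymm hup (hlow.trans hmono), le_antisymm (hmono.trans hup) hlow,
    fun s hs hsδ => exists_tree_of_lt_poincareExponent hb hD hdisc hgen hs hsδ⟩
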